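/- Let $n\ge 0$ and let $f=(f_1,\dots,f_n)$ be a system of polynomials in the variables $X_1,\dots,X_n$ with nonnegative real coefficients, all of total degree at most $2$. Assume that $f$ is feasible, i.e. $y=f(y)$ for some $y\in\mathbb{R}_{\ge 0}^n$, and clean, i.e. for every $j$ there is a $k\in\mathbb{N}$ with $(f^k(0))_j>0$, where $f^k$ is the $k$-fold iterate of $f$. Say that $X_i$ depends directly on $X_k$ if $\partial f_i/\partial X_k$ is not the zero polynomial. Let $h(f)$ be the height of the DAG of strongly connected components (SCCs) of this dependence relation, i.e. the number of edges of a longest path in that DAG ($0$ if $n=0$). Let $f'(x)$ denote the Jacobian matrix of $f$ at $x$, and $I$ the identity matrix. Then $f$ has a least fixed point $\mu f$ in $\mathbb{R}_{\ge 0}^n$ (with respect to the componentwise order), and the Newton sequence $$\nu^{(0)}=0,\qquad \nu^{(k+1)}=\nu^{(k)}+\bigl(I-f'(\nu^{(k)})\bigr)^{-1}\bigl(f(\nu^{(k)})-\nu^{(k)}\bigr)$$ of the whole (undecomposed) system is well-defined, i.e. $I-f'(\nu^{(k)})$ is invertible for every $k\ge 0$. It converges linearly to $\mu f$: there are real $C$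 and $q\in[0,1)$ with $\|\nu^{(k)}-\mu f\|_\infty\le C q^k$ for all $k\ge 0$. More precisely, there is a $k_f\in\mathbb{N}$ such that for every integer $i\ge 0$ the vector $\nu=\nu^{(k_f+i\,(h(f)+1)\,2^{h(f)})}$ has at least $i$ valid bits of $\mu f$, i.e. $$\frac{|(\mu f)_j-\nu_j|}{|(\mu f)_j|}\le 2^{-i}\qquad\text{for every } 1\le j\le n.$$ -/

import Mathlib

open Filter Topology

noncomputable section

namespace MSP

variable {σ : Type*}

/-- A monotone system of polynomials: every component is a polynomial in the variables
`σ` with nonnegative real coefficients. -/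
def IsMSP (f : σ → MvPolynomial σ ℝ) : Prop :=
  ∀ i m, 0 ≤ (f i).coeff m

/-- Every monomial has degree at most two. -/
def IsQuadratic (f : σ → MvPolynomial σ ℝ) : Prop :=
  ∀ i, (f i).totalDegree ≤ 2

/-- The value `f(x)` of the system at the vector `x`. -/
def value (f : σ → MvPolynomial σ ℝ) (x : σ → ℝ) : σ → ℝ :=
  fun i => MvPolynomial.eval x (f i)

/-- The nonnegative fixed points of the system. -/
def fixedPts (f : σ → MvPolynomial σ ℝ) : Set (σ → ℝ) :=
  {y | 0 ≤ y ∧ value f y = y}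

def IsFeasible (f : σ → MvPolynomial σ ℝ) : Prop :=
  (fixedPts f).Nonempty

/-- The Kleene sequence `0, f(0), f(f(0)), …`. -/
def kleene (f : σ → MvPolynomial σ ℝ) (k : ℕ) : σ → ℝ :=
  (value f)^[k] 0

/-- All variables are productive. -/
def IsClean (f : σ → MvPolynomial σ ℝ) : Prop :=
  ∀ i, ∃ k, 0 < kleene f k i

/-- The Jacobian matrix of the system at `x`. -/
def jacobian (f : σ → MvPolynomial σ ℝ) (x : σ → ℝ) : Matrix σ σ ℝ :=
  Matrix.of fun i k => MvPolynomial.eval x (MvPolynomial.pderiv k (f i))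

/-- The Newton operator `x ↦ x + (1 - f'(x))⁻¹ (f(x) - x)`; the inverse is meaningful only if
`1 - f'(x)` is invertible. -/
def newtonOp [Fintype σ] [DecidableEq σ] (f : σ → MvPolynomial σ ℝ) (x : σ → ℝ) : σ → ℝ :=
  x + (1 - jacobian f x)⁻¹.mulVec (value f x - x)

/-- The Newton sequence started at `0`. -/
def newton [Fintype σ] [DecidableEq σ] (f : σ → MvPolynomial σ ℝ) (k : ℕ) : σ → ℝ :=
  (newtonOp f)^[k] 0

/-- `X i` depends directly on `X k`. -/
def DependsDirectly (f : σ → MvPolynomial σ ℝ) (i k : σ) : Prop :=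
  MvPolynomial.pderiv k (f i) ≠ 0

/-- `X i` depends on `X k`. -/
def Depends (f : σ → MvPolynomial σ ℝ) : σ → σ → Prop :=
  Relation.ReflTransGen (DependsDirectly f)

/-- Mutual dependence of variables. -/
def mutualSetoid (f : σ → MvPolynomial σ ℝ) : Setoid σ where
  r i k := Depends f i k ∧ Depends f k i
  iseqv :=
    { refl := fun _ => ⟨.refl, .refl⟩
      symm := fun h => ⟨h.2, h.1⟩
      trans := fun h h' => ⟨h.1.trans h'.1, h'.2.trans h.2⟩ }

/-- The strongly connected components, as classes of mutually dependent variables. -/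
abbrev SCC (f : σ → MvPolynomial σ ℝ) : Type _ :=
  Quotient (mutualSetoid f)

/-- The component containing the variable `X i`. -/
def sccOf (f : σ → MvPolynomial σ ℝ) (i : σ) : SCC f :=
  Quotient.mk (mutualSetoid f) i

/-- The edges of the DAG of strongly connected components. -/
def sccEdge (f : σ → MvPolynomial σ ℝ) : SetRel (SCC f) (SCC f) :=
  {p | p.1 ≠ p.2 ∧ ∃ i k, sccOf f i = p.1 ∧ sccOf f k = p.2 ∧ DependsDirectly f i k}

/-- The lengths (numbers of edges) of the paths in the DAG of components. -/
def pathLengths (f : σ → MvPolynomial σ ℝ) : Set ℕ :=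
  {l | ∃ p : RelSeries (sccEdge f), p.length = l}

/-- The height of the DAG of components: the length of a longest path. -/
def height (f : σ → MvPolynomial σ ℝ) : ℕ :=
  sSup (pathLengths f)

theorem depends_of_lt {f : σ → MvPolynomial σ ℝ} (p : RelSeries (sccEdge f)) :
    ∀ (b a : ℕ) (ha : a ≤ b) (hb : b < p.length + 1) (x y : σ),
      sccOf f x = p ⟨a, by omega⟩ → sccOf f y = p ⟨b, hb⟩ → Depends f x y := by
  intro b
  induction b with
  | zero =>
    intro a ha hb x y hx hy
    obtain rfl : a = 0 := by omega
    exact (Quotient.exact (hx.trans hy.symm) : (mutualSetoid f).r x y).1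
  | succ b ih =>
    intro a ha hb x y hx hy
    rcases Nat.lt_or_ge a (b + 1) with h | h
    · obtain ⟨-, i, k, hi, hk, hik⟩ := p.step ⟨b, by omega⟩
      have h1 : Depends f x i := ih a (by omega) (by omega) x i hx hi
      have h2 : Depends f k y :=
        (Quotient.exact (hk.trans hy.symm) : (mutualSetoid f).r k y).1
      exact (h1.tail hik).trans h2
    · obtain rfl : a = b + 1 := by omega
      exact (Quotient.exact (hx.trans hy.symm) : (mutualSetoid f).r x y).1

/-- No path visits a component twice, so for finitely many variables path lengths are bounded
and the height is the actual maximum (`0` if there are no variables). -/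
theorem bddAbove_pathLengths [Finite σ] (f : σ → MvPolynomial σ ℝ) :
    BddAbove (pathLengths f) := by
  have : Finite (SCC f) := Quotient.finite _
  refine ⟨Nat.card (SCC f), ?_⟩
  rintro l ⟨p, rfl⟩
  have key : ∀ a b : Fin (p.length + 1), a < b → p a ≠ p b := by
    intro a b hab heq
    have hab' : a.1 < b.1 := hab
    obtain ⟨hne, i, k, hi, hk, hik⟩ := p.step ⟨a.1, by omega⟩
    obtain ⟨y, hy⟩ := Quotient.exists_rep (p b)
    have h1 : Depends f k y := depends_of_lt p b.1 (a.1 + 1) hab' b.2 k y hk hy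
    have h2 : Depends f y i :=
      (Quotient.exact (hy.trans (heq.symm.trans hi.symm)) : (mutualSetoid f).r y i).1
    refine hne (hi.symm.trans (Eq.trans ?_ hk))
    exact Quotient.sound
      (show (mutualSetoid f).r i k from ⟨Relation.ReflTransGen.single hik, h1.trans h2⟩)
  have hinj : Function.Injective (fun a : Fin (p.length + 1) => p a) := by
    intro a b hab
    rcases lt_trichotomy a b with h | h | h
    · exact absurd hab (key a b h)
    · exact h
    · exact absurd hab.symm (key b a h)
  have := Nat.card_le_card_of_injective _ hinj
  simp only [Nat.card_eq_fintype_card, Fintype.card_fin] at this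
  omega

/-- `v` has (at least) `i` valid bits of `μ`. -/
def HasValidBits (μ v : σ → ℝ) (i : ℕ) : Prop :=
  ∀ j, |μ j - v j| / |μ j| ≤ (2 : ℝ) ^ (-(i : ℤ))

/-- Linear (geometric) convergence: the error, in the maximum norm, is bounded by `C * q ^ k`
with `q < 1`. -/
def ConvergesLinearly [Fintype σ] (x : ℕ → σ → ℝ) (μ : σ → ℝ) : Prop :=
  ∃ C q : ℝ, 0 ≤ q ∧ q < 1 ∧ ∀ k, ‖x k - μ‖ ≤ C * q ^ k

end MSP

end

/-! Degree at most two makes Taylor expansion exact: `F (x + δ) = F x + F' x δ + B (δ, δ)` with `B ≥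
0`. Hence, while `F' x` has spectral radius below one, a Newton step from `x ≤ F x`, `x ≤ μ` has
residual `B (δ, δ) ≥ 0` and error `v = F' x v + B (u, u) ≥ 0`, where `u = μ - x` is the old error.
The iterates thus lie between the Kleene iterates and `μ`.

Well-definedness requires the spectral radius to stay below one. This is expressed by left
subinvariant vectors (`Subcritical`) and propagated in `NewtonInvariant.step`. The key input is
productivity: a nonzero `y ≥ 0` with `y ≤ y F' x`, supported where `x < μ`, would force `F` to
vanish somewhere on the support of `y` where cleanness makes it positive
(`IsProductiveFixedPt.eq_zero_of_le_vecMul`).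

For the rate, fix a component and let `A` be the diagonal block of `F' μ`. It is irreducible and has
a positive `d` with `A d ≤ d`. Since `A ≥ M + 2 B (u, ·)` for the block `M` of `F' x`, a bound `u ≤
t d` gives `(1 - M) (t/2) d ≥ B (u, u)`, so without influence from below one step halves the bound.
Suppose the lower components have error of order `s ^ 2`. Either `u ≤ s d`, which is good enough, or
a Harnack inequality gives `u ≥ const * s * d`, and then `2 B (u, s d)` is of order `s ^ 2` and
compensates the perturbation. In both cases `v ≤ (t/2 + K s) d` (`exists_error_reduction`).

So rate `q ^ 2` below yields rate `q` in the component, provided `q > 1/2`. Each level of the DAG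
costs one square root, and height `h` gives the rate `2 ^ (-1 / 2 ^ h)`, that is, one bit per `2 ^
h` steps. -/

noncomputable section

/-! ### Nonnegative matrices of spectral radius below one -/

namespace MSP

open Matrix

variable {σ : Type*}

/-- A square matrix `M` without nonzero nonnegative left subinvariant vector. For nonnegative
matrices this says that the spectral radius is less than one. -/
def Subcritical [Fintype σ] (M : Matrix σ σ ℝ) : Prop :=
  ∀ y : σ → ℝ, 0 ≤ y → y ≤ y ᵥ* M → y = 0

namespace Subcritical

variable [Fintype σ] {M : Matrix σ σ ℝ}

theorem isUnit [DecidableEq σ] (hM : Subcritical M) (h0 : ∀ i j, 0 ≤ M i j) : IsUnit (1 - M) := by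
  rw [← Matrix.vecMul_injective_iff_isUnit]
  rw [← Matrix.coe_vecMulLinear, injective_iff_map_eq_zero]
  intro v hv
  have hv' : v = v ᵥ* M := by
    have : v ᵥ* (1 - M) = 0 := hv
    rw [Matrix.vecMul_sub, Matrix.vecMul_one, sub_eq_zero] at this
    exact this
  -- Taking absolute values turns an invariant vector into a nonnegative subinvariant one.
  have habs : (fun i => |v i|) = 0 := by
    refine hM _ (fun i => abs_nonneg _) fun i => ?_
    calc |v i| = |∑ j, v j * M j i| := congrArg abs (congrFun hv' i)
      _ ≤ ∑ j, |v j * M j i| := Finset.abs_sum_le_sum_abs _ _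
      _ = ∑ j, |v j| * M j i := by simp only [abs_mul, abs_of_nonneg (h0 _ _)]
  funext i
  exact abs_eq_zero.mp (congrFun habs i)

/-- The negative part of `v` is subinvariant, hence zero. Applied to the rows of `(1 - M)⁻¹`, this
makes the inverse nonnegative. -/
theorem nonneg_of_le_vecMul (hM : Subcritical M) (h0 : ∀ i j, 0 ≤ M i j) {v : σ → ℝ}
    (hv : v ᵥ* M ≤ v) : 0 ≤ v := by
  have h : (fun i => max (-v i) 0) = 0 := by
    refine hM _ (fun i => le_max_right _ _) fun i => max_le ?_ ?_
    · calc -v i ≤ -∑ j, v j * M j i := neg_le_neg (hv i)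
        _ = ∑ j, -v j * M j i := by simp
        _ ≤ ∑ j, max (-v j) 0 * M j i :=
          Finset.sum_le_sum fun j _ => mul_le_mul_of_nonneg_right (le_max_left _ _) (h0 _ _)
    · exact Finset.sum_nonneg fun j _ => mul_nonneg (le_max_right _ _) (h0 _ _)
  intro i
  have := congrFun h i
  have h2 := le_max_left (-v i) 0
  simp only [Pi.zero_apply] at this ⊢
  linarith

variable [DecidableEq σ]

theorem inv_nonneg (hM : Subcritical M) (h0 : ∀ i j, 0 ≤ M i j) (i j : σ) :
    0 ≤ (1 - M)⁻¹ i j := by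
  have hu := (Matrix.isUnit_iff_isUnit_det _).mp (hM.isUnit h0)
  refine hM.nonneg_of_le_vecMul h0 (v := (1 - M)⁻¹ i) ?_ j
  intro k
  have h1 := Matrix.nonsing_inv_mul _ hu
  rw [Matrix.mul_sub, Matrix.mul_one, sub_eq_iff_eq_add] at h1
  have h2 := congrFun (congrFun h1 i) k
  have h3 : (0 : ℝ) ≤ (1 : Matrix σ σ ℝ) i k := by
    rw [Matrix.one_apply]; split_ifs <;> norm_num
  rw [Matrix.add_apply, Matrix.mul_apply_eq_vecMul] at h2
  rw [h2]; linarith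

/-- Comparison principle. -/
theorem nonneg_of_mulVec_le (hM : Subcritical M) (h0 : ∀ i j, 0 ≤ M i j) {v : σ → ℝ}
    (hv : M *ᵥ v ≤ v) : 0 ≤ v := by
  have hu := (Matrix.isUnit_iff_isUnit_det _).mp (hM.isUnit h0)
  have h1 : v = (1 - M)⁻¹ *ᵥ (v - M *ᵥ v) := by
    have : v - M *ᵥ v = (1 - M) *ᵥ v := by rw [Matrix.sub_mulVec, Matrix.one_mulVec]
    rw [this, Matrix.mulVec_mulVec, Matrix.nonsing_inv_mul _ hu, Matrix.one_mulVec]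
  rw [h1]
  exact fun i => Finset.sum_nonneg fun j _ =>
    mul_nonneg (hM.inv_nonneg h0 i j) (sub_nonneg.mpr (hv j))

theorem eq_zero_of_le_mulVec (hM : Subcritical M) (h0 : ∀ i j, 0 ≤ M i j) {e : σ → ℝ}
    (he : 0 ≤ e) (h : e ≤ M *ᵥ e) : e = 0 := by
  refine le_antisymm ?_ he
  have := hM.nonneg_of_mulVec_le h0 (v := -e) (by rw [Matrix.mulVec_neg]; exact neg_le_neg h)
  exact neg_nonneg.mp this

/-- Comparison principle for a principal block. -/
theorem le_of_submatrix (hM : Subcritical M) (h0 : ∀ i j, 0 ≤ M i j) (p : σ → Prop)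
    [DecidablePred p] {v z : {i // p i} → ℝ}
    (h : ∀ i : {i // p i}, v i - ∑ j : {i // p i}, M i j * v j ≤
      z i - ∑ j : {i // p i}, M i j * z j) : v ≤ z := by
  -- The positive part of `v - z`, extended by zero, lies below its image under `M`. Thus no
  -- subcriticality of the block itself is needed.
  have key : (fun i => if hi : p i then max (v ⟨i, hi⟩ - z ⟨i, hi⟩) 0 else 0) = (0 : σ → ℝ) := by
    refine hM.eq_zero_of_le_mulVec h0 (fun i => ?_) fun i => ?_
    · dsimp only; split_ifs
      · exact le_max_right _ _
      · exact le_rfl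
    · have hnn : ∀ j, 0 ≤ (if hj : p j then max (v ⟨j, hj⟩ - z ⟨j, hj⟩) 0 else 0) := by
        intro j; split_ifs
        · exact le_max_right _ _
        · exact le_rfl
      have hR : 0 ≤ (M *ᵥ fun i => if hi : p i then max (v ⟨i, hi⟩ - z ⟨i, hi⟩) 0 else 0) i :=
        Finset.sum_nonneg fun j _ => mul_nonneg (h0 _ _) (hnn j)
      by_cases hi : p i
      · simp only [hi, dif_pos]
        refine max_le ?_ hR
        have h1 := h ⟨i, hi⟩
        have h2 : ∑ j : {i // p i}, M i j * (v j - z j) ≤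
            (M *ᵥ fun i => if hi : p i then max (v ⟨i, hi⟩ - z ⟨i, hi⟩) 0 else 0) i := by
          rw [Matrix.mulVec, dotProduct, ← Fintype.sum_subtype_add_sum_subtype p]
          refine le_add_of_le_of_nonneg (Finset.sum_le_sum fun j _ => ?_)
            (Finset.sum_nonneg fun j _ => mul_nonneg (h0 _ _) (hnn j))
          refine mul_le_mul_of_nonneg_left ?_ (h0 _ _)
          rw [dif_pos j.2]; exact le_max_left _ _
        simp only [mul_sub, Finset.sum_sub_distrib] at h2
        dsimp only at h1
        linarith
      · simp only [hi, dif_neg, not_false_eq_true]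
        exact hR
  intro i
  have := congrFun key i
  simp only [i.2, dif_pos, Pi.zero_apply] at this
  have h2 := le_max_left (v i - z i) 0
  have h3 : max (v i - z i) 0 = 0 := this
  linarith

end Subcritical

/-! ### Quadratic systems: exact Taylor expansion and monotonicity -/

/-- A quadratic system `x ↦ const + lin x + quad (x, x)` with nonnegative coefficients. -/
structure QuadSystem (σ : Type*) where
  const : σ → ℝ
  lin : σ → σ → ℝ
  quad : σ → σ → σ → ℝ
  const_nonneg : ∀ i, 0 ≤ const i
  lin_nonneg : ∀ i j, 0 ≤ lin i j
  quad_nonneg : ∀ i j k, 0 ≤ quad i j k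
  quad_symm : ∀ i j k, quad i j k = quad i k j

namespace QuadSystem

variable [Fintype σ] (F : QuadSystem σ)

/-- The bilinear form of the second-order part. -/
def form (x y : σ → ℝ) (i : σ) : ℝ :=
  ∑ j, ∑ k, F.quad i j k * x j * y k

def val (x : σ → ℝ) (i : σ) : ℝ :=
  F.const i + ∑ j, F.lin i j * x j + F.form x x i

def jac (x : σ → ℝ) : Matrix σ σ ℝ :=
  Matrix.of fun i j => F.lin i j + 2 * ∑ k, F.quad i j k * x k

theorem jac_apply (x : σ → ℝ) (i j : σ) :
    F.jac x i j = F.lin i j + 2 * ∑ k, F.quad i j k * x k := rfl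

theorem form_comm (x y : σ → ℝ) : F.form x y = F.form y x := by
  funext i
  unfold form
  rw [Finset.sum_comm]
  refine Finset.sum_congr rfl fun j _ => Finset.sum_congr rfl fun k _ => ?_
  rw [F.quad_symm i k j]; ring

theorem form_add_left (x y z : σ → ℝ) : F.form (x + y) z = F.form x z + F.form y z := by
  funext i
  simp only [form, Pi.add_apply, ← Finset.sum_add_distrib]
  refine Finset.sum_congr rfl fun j _ => Finset.sum_congr rfl fun k _ => ?_
  ring

theorem form_add_right (x y z : σ → ℝ) : F.form x (y + z) = F.form x y + F.form x z := by
  rw [form_comm, form_add_left, form_comm, F.form_comm z]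

theorem jac_mulVec (x z : σ → ℝ) (i : σ) :
    (F.jac x *ᵥ z) i = ∑ j, F.lin i j * z j + 2 * F.form x z i := by
  rw [form_comm]
  simp only [Matrix.mulVec, dotProduct, jac_apply, form, add_mul, Finset.sum_add_distrib,
    Finset.mul_sum, Finset.sum_mul]
  congr 1
  refine Finset.sum_congr rfl fun j _ => Finset.sum_congr rfl fun k _ => ?_
  ring

theorem val_add (x δ : σ → ℝ) :
    F.val (x + δ) = F.val x + F.jac x *ᵥ δ + F.form δ δ := by
  funext i
  have h : F.form (x + δ) (x + δ) i = F.form x x i + 2 * F.form x δ i + F.form δ δ i := by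
    rw [form_add_left, form_add_right, form_add_right, F.form_comm δ x]
    simp only [Pi.add_apply]; ring
  simp only [Pi.add_apply, jac_mulVec, val, h, mul_add, Finset.sum_add_distrib]
  ring

theorem jac_add_apply (x δ : σ → ℝ) (i j : σ) :
    F.jac (x + δ) i j = F.jac x i j + 2 * ∑ k, F.quad i j k * δ k := by
  simp only [jac_apply, Pi.add_apply, mul_add, Finset.sum_add_distrib]
  ring

variable {x y : σ → ℝ}

theorem form_nonneg (hx : 0 ≤ x) (hy : 0 ≤ y) : 0 ≤ F.form x y := fun _ =>
  Finset.sum_nonneg fun _ _ => Finset.sum_nonneg fun _ _ =>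
    mul_nonneg (mul_nonneg (F.quad_nonneg _ _ _) (hx _)) (hy _)

theorem le_form (hx : 0 ≤ x) (hy : 0 ≤ y) (i j k : σ) :
    F.quad i j k * x j * y k ≤ F.form x y i := by
  have hnn : ∀ j k, 0 ≤ F.quad i j k * x j * y k := fun j k =>
    mul_nonneg (mul_nonneg (F.quad_nonneg _ _ _) (hx _)) (hy _)
  calc F.quad i j k * x j * y k ≤ ∑ k, F.quad i j k * x j * y k :=
        Finset.single_le_sum (f := fun k => F.quad i j k * x j * y k)
          (fun k _ => hnn j k) (Finset.mem_univ k)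
    _ ≤ _ := Finset.single_le_sum (f := fun j => ∑ k, F.quad i j k * x j * y k)
          (fun j _ => Finset.sum_nonneg fun k _ => hnn j k) (Finset.mem_univ j)

theorem jac_nonneg (hx : 0 ≤ x) (i j : σ) : 0 ≤ F.jac x i j :=
  add_nonneg (F.lin_nonneg _ _) (mul_nonneg zero_le_two
    (Finset.sum_nonneg fun _ _ => mul_nonneg (F.quad_nonneg _ _ _) (hx _)))

theorem jac_mono (hxy : x ≤ y) (i j : σ) : F.jac x i j ≤ F.jac y i j := by
  rw [jac_apply, jac_apply]
  gcongr with k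
  · exact F.quad_nonneg _ _ _
  · exact hxy k

theorem quad_le_jac (hx : 0 ≤ x) (i j k : σ) : 2 * (F.quad i j k * x k) ≤ F.jac x i j := by
  have h := Finset.single_le_sum (f := fun k => F.quad i j k * x k)
    (fun k _ => mul_nonneg (F.quad_nonneg i j k) (hx k)) (Finset.mem_univ k)
  have := F.lin_nonneg i j
  rw [jac_apply]
  linarith

theorem le_mulVec_jac {z : σ → ℝ} (hx : 0 ≤ x) (hz : 0 ≤ z) (i j : σ) :
    F.jac x i j * z j ≤ (F.jac x *ᵥ z) i :=
  Finset.single_le_sum (f := fun j => F.jac x i j * z j)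
    (fun j _ => mul_nonneg (F.jac_nonneg hx i j) (hz j)) (Finset.mem_univ j)

theorem mulVec_jac_nonneg {z : σ → ℝ} (hx : 0 ≤ x) (hz : 0 ≤ z) : 0 ≤ F.jac x *ᵥ z := fun _ =>
  Finset.sum_nonneg fun _ _ => mul_nonneg (F.jac_nonneg hx _ _) (hz _)

theorem val_nonneg (hx : 0 ≤ x) : 0 ≤ F.val x := fun i =>
  add_nonneg (add_nonneg (F.const_nonneg i)
    (Finset.sum_nonneg fun _ _ => mul_nonneg (F.lin_nonneg _ _) (hx _))) (F.form_nonneg hx hx i)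

theorem val_mono (hx : 0 ≤ x) (hxy : x ≤ y) : F.val x ≤ F.val y := by
  have h : y = x + (y - x) := by abel
  have h0 : 0 ≤ y - x := sub_nonneg.mpr hxy
  rw [h, val_add, add_assoc]
  exact le_add_of_nonneg_right (add_nonneg (F.mulVec_jac_nonneg hx h0) (F.form_nonneg h0 h0))

theorem continuous_val : Continuous F.val := by
  refine continuous_pi fun i => ?_
  unfold val form; fun_prop

theorem continuous_jac (i j : σ) : Continuous fun x => F.jac x i j := by
  simp only [jac_apply]; fun_prop

end QuadSystem

end MSP

end

/-! ### Newton iterates stay below the fixed point and subcritical -/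

noncomputable section

namespace MSP

open Matrix

variable {σ : Type*}

namespace QuadSystem

variable [Fintype σ] (F : QuadSystem σ)

/-- No nonempty set `p` of components vanishes when its own variables are set to zero and the
others keep their value in `μ`. -/
def ProductiveAt (μ : σ → ℝ) : Prop :=
  ∀ (p : σ → Prop) [DecidablePred p], (∃ i, p i) →
    ∃ i, p i ∧ 0 < F.val (fun j => if p j then 0 else μ j) i

/-- A positive fixed point at which all components are productive. -/
structure IsProductiveFixedPt (μ : σ → ℝ) : Prop where
  pos : ∀ i, 0 < μ i
  val_eq : F.val μ = μ
  productive : F.ProductiveAt μ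

variable {F} {μ x y : σ → ℝ}

theorem sub_eq_of_fixed (hμ : F.val μ = μ) (x : σ → ℝ) :
    μ - x = F.jac x *ᵥ (μ - x) + (F.val x - x) + F.form (μ - x) (μ - x) := by
  have h := F.val_add x (μ - x)
  rw [add_sub_cancel, hμ] at h
  nth_rw 1 [h]
  abel

theorem jac_mulVec_error_le (hμ : F.val μ = μ) (hxf : x ≤ F.val x) (hxμ : x ≤ μ) :
    F.jac x *ᵥ (μ - x) ≤ μ - x := by
  have h0 : 0 ≤ μ - x := sub_nonneg.mpr hxμ
  conv_rhs => rw [sub_eq_of_fixed hμ x]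
  rw [add_assoc]
  exact le_add_of_nonneg_right (add_nonneg (sub_nonneg.mpr hxf) (F.form_nonneg h0 h0))

/-- Pairing the error equation with `y` shows that `F` has no quadratic terms inside the support of
`y`. Setting the variables of the support to zero and all others to `μ` therefore does not decrease
the Jacobian on the support, and pairing the expansion of `F μ` at that point with `y` contradicts
productivity. -/
theorem IsProductiveFixedPt.eq_zero_of_le_vecMul (hμ : F.IsProductiveFixedPt μ)
    (hxf : x ≤ F.val x) (hxμ : x ≤ μ) (hy : 0 ≤ y) (hsupp : ∀ i, x i = μ i → y i = 0)
    (hyM : y ≤ y ᵥ* F.jac x) : y = 0 := by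
  classical
  by_contra hne
  have hex : ∃ i, 0 < y i := by
    by_contra! h
    exact hne (le_antisymm h hy)
  obtain ⟨i₀, hi₀, hval⟩ := hμ.productive (fun i => 0 < y i) hex
  set z : σ → ℝ := fun j => if 0 < y j then 0 else μ j with hz
  set w := μ - x with hw
  have hw0 : 0 ≤ w := sub_nonneg.mpr hxμ
  have hwpos : ∀ i, 0 < y i → 0 < w i := fun i hi =>
    sub_pos.mpr (lt_of_le_of_ne (hxμ i) fun h => hi.ne' (hsupp i h))
  have hz0 : 0 ≤ z := by
    intro j; simp only [hz]; split_ifs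
    · exact le_rfl
    · exact (hμ.pos j).le
  -- In `y ⬝ᵥ w = (y ᵥ* F.jac x) ⬝ᵥ w + y ⬝ᵥ (F.val x - x) + y ⬝ᵥ F.form w w` the first summand
  -- already reaches the left side, and the others are nonnegative.
  have hform : y ⬝ᵥ F.form w w = 0 := by
    refine le_antisymm ?_ (dotProduct_nonneg_of_nonneg hy (F.form_nonneg hw0 hw0))
    have h1 := congrArg (fun v => y ⬝ᵥ v) (sub_eq_of_fixed hμ.val_eq x)
    simp only [dotProduct_add] at h1
    rw [Matrix.dotProduct_mulVec] at h1
    have h2 : y ⬝ᵥ w ≤ (y ᵥ* F.jac x) ⬝ᵥ w := dotProduct_le_dotProduct_of_nonneg_right hyM hw0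
    have h3 : 0 ≤ y ⬝ᵥ (F.val x - x) :=
      dotProduct_nonneg_of_nonneg hy (sub_nonneg.mpr hxf)
    linarith
  have hform' : ∀ l, 0 < y l → F.form w w l = 0 := by
    intro l hl
    have := (Finset.sum_eq_zero_iff_of_nonneg
      (fun i _ => mul_nonneg (hy i) (F.form_nonneg hw0 hw0 i))).mp hform l (Finset.mem_univ l)
    exact (mul_eq_zero.mp this).resolve_left hl.ne'
  have hjac : ∀ l i, 0 < y l → 0 < y i → F.jac x l i ≤ F.jac z l i := by
    intro l i hl hi
    rw [jac_apply, jac_apply]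
    gcongr 2 with k
    refine Finset.sum_le_sum fun k _ => ?_
    by_cases hk : 0 < y k
    · have h1 := F.le_form hw0 hw0 l i k
      rw [hform' l hl, mul_assoc] at h1
      have h2 : F.quad l i k = 0 := by
        refine le_antisymm ?_ (F.quad_nonneg _ _ _)
        exact nonpos_of_mul_nonpos_left h1 (mul_pos (hwpos i hi) (hwpos k hk))
      simp [h2]
    · refine mul_le_mul_of_nonneg_left ?_ (F.quad_nonneg _ _ _)
      simp only [hz, hk, if_false]
      exact hxμ k
  set ζ : σ → ℝ := μ - z with hζ
  have hζ0 : 0 ≤ ζ := by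
    intro j
    simp only [hζ, hz, Pi.sub_apply, Pi.zero_apply]
    split_ifs
    · simpa using (hμ.pos j).le
    · simp
  have hζy : ∀ i, ¬ 0 < y i → ζ i = 0 := by
    intro i hi; simp [hζ, hz, hi]
  have hyζ : y ⬝ᵥ ζ = y ⬝ᵥ μ := by
    refine Finset.sum_congr rfl fun i _ => ?_
    by_cases hi : 0 < y i
    · simp [hζ, hz, hi]
    · have : y i = 0 := le_antisymm (not_lt.mp hi) (hy i)
      simp [this]
  have h1 := congrArg (fun v => y ⬝ᵥ v) (F.val_add z ζ)
  have hzζ : z + ζ = μ := add_sub_cancel _ _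
  simp only [hzζ, hμ.val_eq, dotProduct_add] at h1
  rw [Matrix.dotProduct_mulVec] at h1
  have h2 : y ⬝ᵥ ζ ≤ (y ᵥ* F.jac z) ⬝ᵥ ζ := by
    refine Finset.sum_le_sum fun i _ => ?_
    by_cases hi : 0 < y i
    · refine mul_le_mul_of_nonneg_right ((hyM i).trans ?_) (hζ0 i)
      refine Finset.sum_le_sum fun l _ => ?_
      by_cases hl : 0 < y l
      · exact mul_le_mul_of_nonneg_left (hjac l i hl hi) (hy l)
      · have : y l = 0 := le_antisymm (not_lt.mp hl) (hy l)
        simp [this]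
    · simp [hζy i hi]
  have h3 : 0 ≤ y ⬝ᵥ F.form ζ ζ := dotProduct_nonneg_of_nonneg hy (F.form_nonneg hζ0 hζ0)
  have h4 : 0 < y ⬝ᵥ F.val z :=
    Finset.sum_pos' (fun i _ => mul_nonneg (hy i) (F.val_nonneg hz0 i))
      ⟨i₀, Finset.mem_univ _, mul_pos hi₀ hval⟩
  linarith

/-- The properties of Newton iterates which are preserved by a Newton step. -/
structure NewtonInvariant (F : QuadSystem σ) (μ x : σ → ℝ) : Prop where
  nonneg : 0 ≤ x
  le_val : x ≤ F.val x
  le_fixed : x ≤ μ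
  subcritical : Subcritical (F.jac x)

theorem IsProductiveFixedPt.newtonInvariant_zero (hμ : F.IsProductiveFixedPt μ) :
    F.NewtonInvariant μ 0 where
  nonneg := le_rfl
  le_val := F.val_nonneg le_rfl
  le_fixed := fun i => (hμ.pos i).le
  subcritical := fun _ hy => hμ.eq_zero_of_le_vecMul (F.val_nonneg le_rfl)
    (fun i => (hμ.pos i).le) hy fun i h => absurd h (hμ.pos i).ne

/-- `x'` is a Newton step from `x`. -/
def IsNewtonStep (F : QuadSystem σ) (x x' : σ → ℝ) : Prop :=
  x' - x = F.jac x *ᵥ (x' - x) + (F.val x - x)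

variable {x' : σ → ℝ}

theorem IsNewtonStep.residual (h : F.IsNewtonStep x x') :
    F.val x' - x' = F.form (x' - x) (x' - x) := by
  have h1 := F.val_add x (x' - x)
  rw [add_sub_cancel] at h1
  have h2 : x' - x = F.jac x *ᵥ (x' - x) + (F.val x - x) := h
  funext i
  have h3 := congrFun h1 i
  have h4 := congrFun h2 i
  simp only [Pi.add_apply, Pi.sub_apply] at h3 h4 ⊢
  linarith

theorem IsNewtonStep.error (h : F.IsNewtonStep x x') (hμ : F.val μ = μ) :
    μ - x' = F.jac x *ᵥ (μ - x') + F.form (μ - x) (μ - x) := by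
  have h1 := sub_eq_of_fixed hμ x
  have h2 : x' - x = F.jac x *ᵥ (x' - x) + (F.val x - x) := h
  have h3 : μ - x' = (μ - x) - (x' - x) := by abel
  rw [h3, Matrix.mulVec_sub]
  nth_rw 1 [h1, h2]
  abel

namespace NewtonInvariant

theorem le_step [DecidableEq σ] (hx : F.NewtonInvariant μ x)
    (h : F.IsNewtonStep x x') : x ≤ x' := by
  refine sub_nonneg.mp (hx.subcritical.nonneg_of_mulVec_le (F.jac_nonneg hx.nonneg) ?_)
  have h2 : x' - x = F.jac x *ᵥ (x' - x) + (F.val x - x) := h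
  nth_rw 2 [h2]
  exact le_add_of_nonneg_right (sub_nonneg.mpr hx.le_val)

theorem val_le_step [DecidableEq σ] (hx : F.NewtonInvariant μ x)
    (h : F.IsNewtonStep x x') : F.val x ≤ x' := by
  have h2 : x' - x = F.jac x *ᵥ (x' - x) + (F.val x - x) := h
  have h3 := F.mulVec_jac_nonneg hx.nonneg (sub_nonneg.mpr (hx.le_step h))
  have h4 : F.val x - x ≤ x' - x := by
    rw [h2]; exact le_add_of_nonneg_left h3
  exact (sub_le_sub_iff_right x).mp h4

theorem form_le_error [DecidableEq σ] (hx : F.NewtonInvariant μ x)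
    (h : F.IsNewtonStep x x') (hμ : F.val μ = μ) :
    x' ≤ μ ∧ F.form (μ - x) (μ - x) ≤ μ - x' := by
  have hu : 0 ≤ μ - x := sub_nonneg.mpr hx.le_fixed
  have h1 := h.error hμ
  have hw : 0 ≤ μ - x' := by
    refine hx.subcritical.nonneg_of_mulVec_le (F.jac_nonneg hx.nonneg) ?_
    nth_rw 2 [h1]
    exact le_add_of_nonneg_right (F.form_nonneg hu hu)
  refine ⟨sub_nonneg.mp hw, ?_⟩
  rw [h1]
  exact le_add_of_nonneg_left (F.mulVec_jac_nonneg hx.nonneg hw)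

/-- For subcriticality at `x'`, a subinvariant `y ≥ 0` is shown to vanish in three stages: where the
new error `w` is positive, by productivity; where the old error `u` is positive, because there the
two Jacobians agree on the relevant entries; and where `u = 0`, because the Jacobians agree on the
remaining support of `y`. -/
theorem step [DecidableEq σ] (hx : F.NewtonInvariant μ x)
    (hμ : F.IsProductiveFixedPt μ) (h : F.IsNewtonStep x x') :
    F.NewtonInvariant μ x' := by
  have hle := hx.le_step h
  have hx0 : 0 ≤ x' := hx.nonneg.trans hle
  obtain ⟨hxμ, hform⟩ := hx.form_le_error h hμ.val_eq
  have hδ0 : 0 ≤ x' - x := sub_nonneg.mpr hle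
  have hres : x' ≤ F.val x' := by
    rw [← sub_nonneg, h.residual]; exact F.form_nonneg hδ0 hδ0
  refine ⟨hx0, hres, hxμ, fun y hy hyM => ?_⟩
  set w := μ - x' with hw
  set u := μ - x with hu
  set δ := x' - x with hδ
  have hw0 : 0 ≤ w := sub_nonneg.mpr hxμ
  have hu0 : 0 ≤ u := sub_nonneg.mpr hx.le_fixed
  have hδu : δ ≤ u := sub_le_sub_right hxμ x
  have hMw : F.jac x' *ᵥ w ≤ w := jac_mulVec_error_le hμ.val_eq hres hxμ
  have hMu : F.jac x *ᵥ u ≤ u := jac_mulVec_error_le hμ.val_eq hx.le_val hx.le_fixed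
  -- rows of vanishing error vanish on the columns of positive error
  have hcol : ∀ {a v : σ → ℝ}, 0 ≤ a → 0 ≤ v → F.jac a *ᵥ v ≤ v → ∀ l i, v l = 0 → 0 < v i →
      F.jac a l i = 0 := by
    intro a v ha hv hav l i hl hi
    have h1 := F.le_mulVec_jac ha hv l i
    have h2 := hav l
    rw [hl] at h2
    exact le_antisymm (nonpos_of_mul_nonpos_left (h1.trans h2) hi) (F.jac_nonneg ha l i)
  have hrestrict : ∀ (p : σ → Prop) [DecidablePred p],
      (∀ l i, 0 < y l → ¬ p l → p i → F.jac x' l i = 0) →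
      ∀ i, p i → y i ≤ ((fun i => if p i then y i else 0) ᵥ* F.jac x') i := by
    intro p _ hp i hi
    refine (hyM i).trans (Finset.sum_le_sum fun l _ => ?_)
    by_cases hl : p l
    · simp [hl]
    · rcases (hy l).eq_or_lt with h0 | h0
      · simp [hl, ← h0]
      · simp [hl, hp l i h0 hl hi]
  have hite0 : ∀ (p : σ → Prop) [DecidablePred p], (0 : σ → ℝ) ≤ fun i => if p i then y i else 0 := by
    intro p _ i
    dsimp only
    split_ifs
    · exact hy i
    · exact le_rfl
  -- `y` vanishes where the new error is positive
  have hyw : ∀ i, 0 < w i → y i = 0 := by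
    classical
    have hz := hμ.eq_zero_of_le_vecMul (y := fun i => if 0 < w i then y i else 0)
      hres hxμ (hite0 _) (fun i hi => by simp [hw, hi]) ?_
    · intro i hi
      have := congrFun hz i
      simpa [hi] using this
    · intro i
      by_cases hi : 0 < w i
      · have := hrestrict (fun i => 0 < w i) (fun l i _ hl hi =>
          hcol hx0 hw0 hMw l i (le_antisymm (not_lt.mp hl) (hw0 l)) hi) i hi
        simpa only [hi, if_true] using this
      · simp only [hi, if_false]
        exact Finset.sum_nonneg fun l _ => mul_nonneg (hite0 (fun i => 0 < w i) l) (F.jac_nonneg hx0 _ _)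
  -- On the support of `y` the new error is zero, and it dominates `F.form u u`.
  have hwy : ∀ l, 0 < y l → F.form u u l = 0 := by
    intro l hl
    have h1 : w l = 0 := by
      by_contra hne
      exact hl.ne' (hyw l (lt_of_le_of_ne (hw0 l) (Ne.symm hne)))
    exact le_antisymm ((hform l).trans h1.le) (F.form_nonneg hu0 hu0 l)
  have hquad : ∀ l i k, 0 < y l → 0 < u i → 0 < u k → F.quad l i k = 0 := by
    intro l i k hl hi hk
    have h1 := F.le_form hu0 hu0 l i k
    rw [hwy l hl, mul_assoc] at h1
    exact le_antisymm (nonpos_of_mul_nonpos_left h1 (mul_pos hi hk)) (F.quad_nonneg _ _ _)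
  have hjac' : ∀ l i, F.jac x' l i = F.jac x l i + 2 * ∑ k, F.quad l i k * δ k := by
    intro l i
    rw [← F.jac_add_apply x δ, hδ, add_sub_cancel]
  have hsame : ∀ l i, (∀ k, 0 < u k → F.quad l i k = 0) → F.jac x' l i = F.jac x l i := by
    intro l i hq
    rw [hjac', Finset.sum_eq_zero, mul_zero, add_zero]
    intro k _
    rcases (hu0 k).eq_or_lt with h0 | h0
    · have : δ k = 0 := le_antisymm ((hδu k).trans h0.symm.le) (hδ0 k)
      rw [this, mul_zero]
    · rw [hq k h0, zero_mul]
  -- `y` vanishes where the old error is positive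
  have hyu : ∀ i, 0 < u i → y i = 0 := by
    classical
    have hz := hx.subcritical (fun i => if 0 < u i then y i else 0) (hite0 _) ?_
    · intro i hi
      have := congrFun hz i
      simpa [hi] using this
    · intro i
      by_cases hi : 0 < u i
      · simp only [hi, if_true]
        refine (hrestrict (fun i => 0 < u i) (fun l i hl hnl hi => ?_) i hi).trans
          (Finset.sum_le_sum fun l _ => ?_)
        · rw [hsame l i fun k hk => hquad l i k hl hi hk]
          exact hcol hx.nonneg hu0 hMu l i (le_antisymm (not_lt.mp hnl) (hu0 l)) hi
        · rcases (hy l).eq_or_lt with h0 | h0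
          · simp [← h0]
          · exact (congrArg (_ * ·) (hsame l i fun k hk => hquad l i k h0 hi hk)).le
      · simp only [hi, if_false]
        exact Finset.sum_nonneg fun l _ => mul_nonneg (hite0 (fun i => 0 < u i) l) (F.jac_nonneg hx.nonneg _ _)
  have hu_of_y : ∀ i, 0 < y i → u i = 0 := by
    intro i hi
    by_contra hne
    exact hi.ne' (hyu i (lt_of_le_of_ne (hu0 i) (Ne.symm hne)))
  -- Now `x = μ > 0` on the support of `y`. Since `F.jac x l k = 0` whenever `u l = 0 < u k`, a term
  -- `quad l k i` with `x i > 0` cannot occur, so passing to `x'` leaves the entry `(l, i)`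
  -- unchanged.
  refine hx.subcritical y hy fun i => ?_
  rcases (hy i).eq_or_lt with h0 | h0
  · rw [← h0]
    exact Finset.sum_nonneg fun l _ => mul_nonneg (hy l) (F.jac_nonneg hx.nonneg _ _)
  · refine (hyM i).trans (Finset.sum_le_sum fun l _ => ?_)
    rcases (hy l).eq_or_lt with hl | hl
    · simp [← hl]
    · refine (congrArg (y l * ·) (hsame l i fun k hk => ?_)).le
      have h1 := hcol hx.nonneg hu0 hMu l k (hu_of_y l hl) hk
      have h2 := F.quad_le_jac hx.nonneg l k i
      have h3 : 0 < x i := by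
        have := hu_of_y i h0
        have h4 := hμ.pos i
        simp only [hu, Pi.sub_apply] at this
        linarith
      rw [h1] at h2
      have h5 : F.quad l k i ≤ 0 := nonpos_of_mul_nonpos_left (b := x i) (by linarith) h3
      rw [F.quad_symm]
      exact le_antisymm h5 (F.quad_nonneg _ _ _)

end NewtonInvariant

end QuadSystem

end MSP

end

/-! ### Irreducible nonnegative matrices -/

noncomputable section

namespace MSP

open Matrix

variable {τ : Type*}

/-- The graph of positive entries is strongly connected. -/
def MatConnected (A : Matrix τ τ ℝ) : Prop :=
  ∀ i j, Relation.ReflTransGen (fun a b => 0 < A a b) i j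

theorem exists_pos_forall {ι : Type*} [Finite ι] {P : ι → ℝ → Prop}
    (hP : ∀ i c c', 0 < c' → c' ≤ c → P i c → P i c') (h : ∀ i, ∃ c, 0 < c ∧ P i c) :
    ∃ c, 0 < c ∧ ∀ i, P i c := by
  have h1 : ∀ᶠ c in 𝓝[>] (0 : ℝ), ∀ i, P i c := by
    rw [eventually_all]
    intro i
    obtain ⟨c, hc, hPc⟩ := h i
    filter_upwards [Ioc_mem_nhdsGT hc] with c' hc'
    exact hP i c c' hc'.1 hc'.2 hPc
  obtain ⟨c, hc, hc0⟩ := (h1.and self_mem_nhdsWithin).exists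
  exact ⟨c, hc0, hc⟩

theorem exists_bound_forall {ι : Type*} [Finite ι] (a : ι → ℝ) {b : ι → ℝ} (hb : ∀ i, 0 < b i) :
    ∃ C, 0 ≤ C ∧ ∀ i, a i ≤ C * b i := by
  have h1 : ∀ᶠ C in atTop, ∀ i, a i ≤ C * b i := by
    rw [eventually_all]
    intro i
    filter_upwards [eventually_ge_atTop (a i / b i)] with C hC
    exact (div_le_iff₀ (hb i)).mp hC
  obtain ⟨C, hC, hC0⟩ := (h1.and (eventually_ge_atTop 0)).exists
  exact ⟨C, hC0, hC⟩

variable [Fintype τ] {A : Matrix τ τ ℝ}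

theorem entry_mul_le_mulVec (h0 : ∀ i j, 0 ≤ A i j) {u : τ → ℝ} (hu : 0 ≤ u) (i j : τ) :
    A i j * u j ≤ (A *ᵥ u) i :=
  Finset.single_le_sum (f := fun j => A i j * u j)
    (fun j _ => mul_nonneg (h0 i j) (hu j)) (Finset.mem_univ j)

/-- A Harnack inequality: the components of approximately superinvariant vectors of an irreducible
matrix are comparable. -/
theorem MatConnected.harnack (hA : MatConnected A) (h0 : ∀ i j, 0 ≤ A i j) :
    ∃ c, 0 < c ∧ ∀ u : τ → ℝ, 0 ≤ u → (∀ i, (1 / 2) * (A *ᵥ u) i ≤ u i) →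
      ∀ i j, c * u j ≤ u i := by
  have key : ∃ c, 0 < c ∧ ∀ ij : τ × τ, ∀ u : τ → ℝ, 0 ≤ u →
      (∀ i, (1 / 2) * (A *ᵥ u) i ≤ u i) → c * u ij.2 ≤ u ij.1 := by
    refine exists_pos_forall (fun ij c c' _ hc h u hu hAu =>
      (mul_le_mul_of_nonneg_right hc (hu _)).trans (h u hu hAu)) ?_
    rintro ⟨i, j⟩
    dsimp only
    induction hA i j using Relation.ReflTransGen.head_induction_on with
    | refl => exact ⟨1, one_pos, fun u _ _ => (one_mul _).le⟩
    | @head a b hab _ ih =>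
      obtain ⟨c, hc, h⟩ := ih
      refine ⟨A a b / 2 * c, by positivity, fun u hu hAu => ?_⟩
      calc A a b / 2 * c * u j = A a b / 2 * (c * u j) := mul_assoc _ _ _
        _ ≤ A a b / 2 * u b := mul_le_mul_of_nonneg_left (h u hu hAu) (by positivity)
        _ = 1 / 2 * (A a b * u b) := by ring
        _ ≤ 1 / 2 * (A *ᵥ u) a :=
          mul_le_mul_of_nonneg_left (entry_mul_le_mulVec h0 hu a b) (by norm_num)
        _ ≤ u a := hAu a
  obtain ⟨c, hc, h⟩ := key
  exact ⟨c, hc, fun u hu hAu i j => h (i, j) u hu hAu⟩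

theorem MatConnected.pos_of_mulVec_le (hA : MatConnected A) (h0 : ∀ i j, 0 ≤ A i j) {d : τ → ℝ}
    (hd : 0 ≤ d) (hAd : A *ᵥ d ≤ d) {j : τ} (hj : 0 < d j) (i : τ) : 0 < d i := by
  obtain ⟨c, hc, h⟩ := hA.harnack h0
  refine (mul_pos hc hj).trans_le (h d hd (fun i => ?_) i j)
  have h1 := hAd i
  have h2 := hd i
  simp only [Pi.zero_apply] at h2
  linarith

/-- Compactness of the simplex lets `s` tend to one along normalised vectors; irreducibility then
makes the limit positive in every component. -/
theorem MatConnected.exists_pos_subinvariant (hA : MatConnected A)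
    (h0 : ∀ i j, 0 ≤ A i j)
    (h : ∀ s : ℝ, 0 < s → s < 1 → ∃ w : τ → ℝ, 0 ≤ w ∧ w ≠ 0 ∧ ∀ i, s * (A *ᵥ w) i ≤ w i) :
    ∃ d : τ → ℝ, (∀ i, 0 < d i) ∧ A *ᵥ d ≤ d := by
  have h' : ∀ m : ℕ, ∃ w ∈ stdSimplex ℝ τ, ∀ i, (1 - 1 / ((m : ℝ) + 2)) * (A *ᵥ w) i ≤ w i := by
    intro m
    have hm : (0 : ℝ) < (m : ℝ) + 2 := by positivity
    have hm1 : 1 / ((m : ℝ) + 2) < 1 := by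
      rw [div_lt_one hm]; linarith [(Nat.cast_nonneg m : (0 : ℝ) ≤ m)]
    obtain ⟨w, hw, hw0, hAw⟩ := h (1 - 1 / ((m : ℝ) + 2)) (by linarith)
      (by have : 0 < 1 / ((m : ℝ) + 2) := by positivity
          linarith)
    have hS : 0 < ∑ i, w i := by
      refine Finset.sum_pos' (fun i _ => hw i) ?_
      by_contra! hcon
      exact hw0 (le_antisymm (fun i => hcon i (Finset.mem_univ i)) hw)
    refine ⟨(∑ i, w i)⁻¹ • w, ⟨fun i => mul_nonneg (inv_nonneg.mpr hS.le) (hw i), ?_⟩, fun i => ?_⟩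
    · simp only [Pi.smul_apply, smul_eq_mul, ← Finset.mul_sum]
      exact inv_mul_cancel₀ hS.ne'
    · rw [Matrix.mulVec_smul]
      simp only [Pi.smul_apply, smul_eq_mul]
      calc _ = (∑ i, w i)⁻¹ * ((1 - 1 / ((m : ℝ) + 2)) * (A *ᵥ w) i) := by ring
        _ ≤ _ := mul_le_mul_of_nonneg_left (hAw i) (inv_nonneg.mpr hS.le)
  choose w hwmem hw using h'
  obtain ⟨d, hd, φ, hφ, hlim⟩ := (isCompact_stdSimplex ℝ τ).tendsto_subseq hwmem
  have hAd : A *ᵥ d ≤ d := by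
    intro i
    have h1 : Tendsto (fun m => (1 - 1 / (((φ m : ℕ) : ℝ) + 2)) * (A *ᵥ w (φ m)) i) atTop
        (𝓝 ((1 - 0) * (A *ᵥ d) i)) := by
      refine Tendsto.mul (tendsto_const_nhds.sub ?_) ?_
      · have : Tendsto (fun x : ℝ => 1 / (x + 2)) atTop (𝓝 0) := by
          simp only [one_div]
          exact tendsto_inv_atTop_zero.comp (tendsto_atTop_add_const_right _ _ tendsto_id)
        exact this.comp (tendsto_natCast_atTop_atTop.comp hφ.tendsto_atTop)
      · have hc : Continuous fun v : τ → ℝ => (A *ᵥ v) i := by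
          simp only [Matrix.mulVec, dotProduct]; fun_prop
        exact (hc.tendsto d).comp hlim
    have h2 : Tendsto (fun m => w (φ m) i) atTop (𝓝 (d i)) :=
      ((continuous_apply i).tendsto d).comp hlim
    have := le_of_tendsto_of_tendsto' h1 h2 fun m => hw (φ m) i
    simpa using this
  have hj : ∃ j, 0 < d j := by
    by_contra! hcon
    have := hd.2
    linarith [Finset.sum_nonpos fun i (_ : i ∈ Finset.univ) => hcon i]
  obtain ⟨j, hj⟩ := hj
  exact ⟨d, hA.pos_of_mulVec_le h0 hd.1 hAd hj, hAd⟩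

/-- For an irreducible matrix `A` with positive subinvariant vector, the equation
`(1 - A) p = 1` has a supersolution modulo multiples of a nonzero `g ≥ 0`. -/
theorem MatConnected.exists_supersolution [DecidableEq τ] (hA : MatConnected A)
    (h0 : ∀ i j, 0 ≤ A i j) {d g : τ → ℝ} (hd : ∀ i, 0 < d i) (hAd : A *ᵥ d ≤ d) (hg : 0 ≤ g)
    {i₀ : τ} (hi₀ : 0 < g i₀) :
    ∃ p : τ → ℝ, ∃ a : ℝ, 0 ≤ p ∧ 0 ≤ a ∧ ∀ i, 1 ≤ p i - (A *ᵥ p) i + a * g i := by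
  -- Each unit vector is treated separately, along a path from `i` to `i₀`. Subtracting `c` times
  -- the unit vector at `j` cancels the gain at `j` and adds `c` times column `j` of `A`, which is
  -- positive at the predecessor `i`.
  have key : ∀ i, ∃ p : τ → ℝ, ∃ a c : ℝ, 0 ≤ a ∧ 0 < c ∧
      ∀ k, c * (Pi.single i 1 : τ → ℝ) k ≤ p k - (A *ᵥ p) k + a * g k := by
    intro i
    induction hA i i₀ using Relation.ReflTransGen.head_induction_on with
    | refl =>
      refine ⟨0, 1, g i₀, zero_le_one, hi₀, fun k => ?_⟩
      simp only [Matrix.mulVec_zero, Pi.zero_apply, sub_zero, zero_add, one_mul]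
      rcases eq_or_ne k i₀ with rfl | hk
      · simp
      · simpa [hk] using hg k
    | @head i j hij _ ih =>
      obtain ⟨p, a, c, ha, hc, h⟩ := ih
      refine ⟨p - c • Pi.single j 1, a, c * A i j, ha, mul_pos hc hij, fun k => ?_⟩
      have h1 := h k
      rw [Matrix.mulVec_sub, Matrix.mulVec_smul, Matrix.mulVec_single_one]
      simp only [Pi.sub_apply, Pi.smul_apply, smul_eq_mul, Matrix.col_apply]
      have h2 : c * A i j * (Pi.single i 1 : τ → ℝ) k ≤ c * A k j := by
        rcases eq_or_ne k i with rfl | hk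
        · simp
        · simpa [hk] using mul_nonneg hc.le (h0 k j)
      linarith
  choose p a c ha hc h using key
  set P : τ → ℝ := ∑ i, (c i)⁻¹ • p i with hP
  set α : ℝ := ∑ i, (c i)⁻¹ * a i with hα
  have hsum : ∀ k, 1 ≤ P k - (A *ᵥ P) k + α * g k := by
    intro k
    have h1 : ∀ i ∈ Finset.univ, (Pi.single i 1 : τ → ℝ) k ≤
        (c i)⁻¹ * (p i k - (A *ᵥ p i) k + a i * g k) := by
      intro i _
      calc (Pi.single i 1 : τ → ℝ) k = (c i)⁻¹ * (c i * (Pi.single i 1 : τ → ℝ) k) := by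
            rw [inv_mul_cancel_left₀ (hc i).ne']
        _ ≤ _ := mul_le_mul_of_nonneg_left (h i k) (inv_nonneg.mpr (hc i).le)
    have h2 := Finset.sum_le_sum h1
    have h3 : ∑ i, (Pi.single i 1 : τ → ℝ) k = 1 := by
      simp [Pi.single_apply]
    have h4 : (A *ᵥ P) k = ∑ i, (c i)⁻¹ * (A *ᵥ p i) k := by
      rw [hP, Matrix.mulVec_sum, Finset.sum_apply]
      simp only [Matrix.mulVec_smul, Pi.smul_apply, smul_eq_mul]
    have h5 : P k = ∑ i, (c i)⁻¹ * p i k := by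
      rw [hP, Finset.sum_apply]
      simp only [Pi.smul_apply, smul_eq_mul]
    rw [h3] at h2
    rw [h4, h5, hα, Finset.sum_mul, ← Finset.sum_sub_distrib, ← Finset.sum_add_distrib]
    refine h2.trans_eq (Finset.sum_congr rfl fun i _ => ?_)
    ring
  -- The sum `P` may have negative components. Adding a multiple of `d` repairs this, since `d - A
  -- *ᵥ d ≥ 0`.
  obtain ⟨D, hD, hPD⟩ := exists_bound_forall (fun i => -P i) hd
  refine ⟨P + D • d, α, fun i => ?_, Finset.sum_nonneg fun i _ =>
    mul_nonneg (inv_nonneg.mpr (hc i).le) (ha i), fun k => (hsum k).trans ?_⟩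
  · have := hPD i
    simp only [Pi.zero_apply, Pi.add_apply, Pi.smul_apply, smul_eq_mul]
    linarith
  · rw [Matrix.mulVec_add, Matrix.mulVec_smul]
    simp only [Pi.add_apply, Pi.smul_apply, smul_eq_mul]
    have := mul_le_mul_of_nonneg_left (hAd k) hD
    linarith

/-! ### Error reduction by one Newton step in an irreducible block -/

namespace QuadSystem

variable (G : QuadSystem τ)

theorem form_smul_right (c : ℝ) (x y : τ → ℝ) : G.form x (c • y) = c • G.form x y := by
  funext i
  simp only [form, Pi.smul_apply, smul_eq_mul, Finset.mul_sum]
  refine Finset.sum_congr rfl fun j _ => Finset.sum_congr rfl fun k _ => ?_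
  ring

theorem form_smul_left (c : ℝ) (x y : τ → ℝ) : G.form (c • x) y = c • G.form x y := by
  rw [form_comm, form_smul_right, form_comm]

theorem form_mono_left {x x' y : τ → ℝ} (h : x ≤ x') (hy : 0 ≤ y) :
    G.form x y ≤ G.form x' y := by
  have h1 := G.form_nonneg (sub_nonneg.mpr h) hy
  have h2 := G.form_add_left x (x' - x) y
  rw [add_sub_cancel] at h2
  rw [h2]
  exact le_add_of_nonneg_right h1

theorem form_mono_right {x y y' : τ → ℝ} (hx : 0 ≤ x) (h : y ≤ y') :
    G.form x y ≤ G.form x y' := by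
  rw [form_comm, G.form_comm x]
  exact G.form_mono_left h hx

/-- The error reduction of one Newton step in a strongly connected component. `u` and `v` are the
errors before and after the step, `s ^ 2` measures the error of the lower components. -/
theorem exists_error_reduction {d p : τ → ℝ} {a κ C : ℝ} (hd : ∀ i, 0 < d i)
    (hAd : A *ᵥ d ≤ d) (hp : 0 ≤ p) (ha : 0 ≤ a) (hκ : 0 < κ) (hC : 0 ≤ C)
    (hsuper : ∀ i, 1 ≤ p i - (A *ᵥ p) i + a * G.form d d i) :
    ∃ K, 0 ≤ K ∧ ∀ (M : Matrix τ τ ℝ) (u v : τ → ℝ) (s t : ℝ), 0 < s → s ≤ 1 → 0 ≤ t →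
      (∀ z : τ → ℝ, (∀ i, v i - (M *ᵥ v) i ≤ z i - (M *ᵥ z) i) → v ≤ z) →
      (∀ z : τ → ℝ, 0 ≤ z → M *ᵥ z + (2 : ℝ) • G.form u z ≤ A *ᵥ z) →
      0 ≤ u → u ≤ t • d → v ≤ u → (∀ i j, κ * u j ≤ u i) →
      (∀ i, v i - (M *ᵥ v) i ≤ G.form u u i + C * s ^ 2) →
      v ≤ (t / 2 + K * s) • d := by
  have hd0 : 0 ≤ d := fun i => (hd i).le
  obtain ⟨κ', hκ', hκd⟩ : ∃ c, 0 < c ∧ ∀ ij : τ × τ, c * d ij.1 ≤ κ * d ij.2 := by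
    refine exists_pos_forall (fun ij c c' _ hc h =>
      (mul_le_mul_of_nonneg_right hc (hd0 _)).trans h) fun ij => ?_
    refine ⟨κ * d ij.2 / d ij.1, div_pos (mul_pos hκ (hd _)) (hd _), ?_⟩
    rw [div_mul_cancel₀ _ (hd _).ne']
  obtain ⟨P, hP, hpP⟩ := exists_bound_forall p hd
  set e := C * a / (2 * κ') with he
  have he0 : 0 ≤ e := by positivity
  -- The `1` serves the case `u ≤ s • d`; `e` and `C * P` come from the two parts of the barrier `z`
  -- below.
  refine ⟨1 + e + C * P, by positivity, ?_⟩
  intro M u v s t hs hs1 ht hcomp hMA hu hut hvu hharn hv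
  by_cases hcase : u ≤ s • d
  · intro i
    refine (hvu i).trans ((hcase i).trans ?_)
    simp only [Pi.smul_apply, smul_eq_mul]
    refine mul_le_mul_of_nonneg_right ?_ (hd0 i)
    have : 0 ≤ (e + C * P) * s := by positivity
    linarith
  · obtain ⟨j, hj⟩ : ∃ j, s * d j < u j := by
      by_contra! h
      exact hcase h
    have hlow : (κ' * s) • d ≤ u := by
      intro i
      simp only [Pi.smul_apply, smul_eq_mul]
      calc κ' * s * d i = s * (κ' * d i) := by ring
        _ ≤ s * (κ * d j) := mul_le_mul_of_nonneg_left (hκd (i, j)) hs.le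
        _ = κ * (s * d j) := by ring
        _ ≤ κ * u j := mul_le_mul_of_nonneg_left hj.le hκ.le
        _ ≤ u i := hharn i j
    -- In `2 * c * G.form u d` the part `t / 2` pays for `G.form u u ≤ t * G.form u d`. The part `e
    -- * s`, by the lower bound on `u`, pays for the deficit `C * s ^ 2 * a * G.form d d` of the
    -- supersolution `p`; this determines `e`.
    set c := t / 2 + e * s with hc
    have hc0 : 0 ≤ c := by positivity
    set z : τ → ℝ := c • d + (C * s ^ 2) • p with hz
    have hz0 : 0 ≤ z := add_nonneg (smul_nonneg hc0 hd0) (smul_nonneg (by positivity) hp)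
    have hvz : v ≤ z := by
      refine hcomp z fun i => (hv i).trans ?_
      have h1 := hMA z hz0 i
      have h2 : G.form u z i = c * G.form u d i + C * s ^ 2 * G.form u p i := by
        rw [hz, form_add_right, form_smul_right, form_smul_right]; rfl
      have h3 : (A *ᵥ z) i = c * (A *ᵥ d) i + C * s ^ 2 * (A *ᵥ p) i := by
        rw [hz, Matrix.mulVec_add, Matrix.mulVec_smul, Matrix.mulVec_smul]; rfl
      have h4 : z i = c * d i + C * s ^ 2 * p i := rfl
      have h5 : G.form u u i ≤ t * G.form u d i := by
        have := G.form_mono_right hu hut i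
        rwa [form_smul_right] at this
      have h6 : κ' * s * G.form d d i ≤ G.form u d i := by
        have := G.form_mono_left hlow hd0 i
        rwa [form_smul_left] at this
      have h7 := mul_le_mul_of_nonneg_left (hAd i) hc0
      have h8 := mul_le_mul_of_nonneg_left (hsuper i) (show 0 ≤ C * s ^ 2 by positivity)
      have h9 : 0 ≤ C * s ^ 2 * G.form u p i :=
        mul_nonneg (by positivity) (G.form_nonneg hu hp i)
      have h10 := mul_le_mul_of_nonneg_left h6 (show 0 ≤ 2 * e * s by positivity)
      have h11 : 2 * e * s * (κ' * s * G.form d d i) = C * s ^ 2 * (a * G.form d d i) := by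
        rw [he]; field_simp
      have h12 : 2 * (c * G.form u d i) = t * G.form u d i + 2 * e * s * G.form u d i := by
        rw [hc]; ring
      simp only [Pi.add_apply, Pi.smul_apply, smul_eq_mul] at h1
      rw [h2, h3] at h1
      rw [h11] at h10
      rw [h4]
      linarith
    refine hvz.trans fun i => ?_
    have h1 : C * s ^ 2 * p i ≤ C * P * s * d i := by
      calc C * s ^ 2 * p i ≤ C * s ^ 2 * (P * d i) :=
            mul_le_mul_of_nonneg_left (hpP i) (by positivity)
        _ = C * P * d i * s ^ 2 := by ring
        _ ≤ C * P * d i * s := by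
          refine mul_le_mul_of_nonneg_left ?_ (mul_nonneg (mul_nonneg hC hP) (hd0 i))
          nlinarith
        _ = _ := by ring
    have h2 := mul_nonneg hs.le (hd0 i)
    simp only [hz, hc, Pi.add_apply, Pi.smul_apply, smul_eq_mul]
    linarith

end QuadSystem

end MSP

end

/-! ### Newton's method restricted to one component -/

noncomputable section

namespace MSP

open Matrix

variable {σ : Type*}

namespace QuadSystem

variable [Fintype σ] (F : QuadSystem σ)

/-- The second-order part of the components in `p`, in the variables of `p`. -/
def block (p : σ → Prop) : QuadSystem {i // p i} where
  const _ := 0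
  lin _ _ := 0
  quad i j k := F.quad i j k
  const_nonneg _ := le_rfl
  lin_nonneg _ _ := le_rfl
  quad_nonneg i j k := F.quad_nonneg i j k
  quad_symm i j k := F.quad_symm i j k

/-- The diagonal block of the Jacobian with indices in `p`. -/
def blockJac (p : σ → Prop) (x : σ → ℝ) : Matrix {i // p i} {i // p i} ℝ :=
  (F.jac x).submatrix Subtype.val Subtype.val

theorem sum_eq_sum_subtype (p : σ → Prop) [DecidablePred p] {g : σ → ℝ}
    (hg : ∀ j, ¬ p j → g j = 0) : ∑ j, g j = ∑ j : {i // p i}, g j := by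
  rw [← Fintype.sum_subtype_add_sum_subtype p, add_eq_left]
  exact Finset.sum_eq_zero fun j _ => hg j j.2

variable {F} {μ : σ → ℝ} {p : σ → Prop} [DecidablePred p]

/-- Otherwise the block would be affine in its own variables with `d` an invariant vector.
Subtracting the largest multiple of `d` that fits below `μ` leaves a superinvariant vector with a
zero, which vanishes by irreducibility; then nothing flows into the block from outside,
contradicting productivity. -/
theorem IsProductiveFixedPt.exists_pos_block (hμ : F.IsProductiveFixedPt μ)
    [Nonempty {i // p i}] (hconn : MatConnected (F.blockJac p μ)) {d : {i // p i} → ℝ}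
    (hd : ∀ i, 0 < d i) (hAd : F.blockJac p μ *ᵥ d ≤ d) :
    ∃ i, 0 < (F.block p).form d d i + (d i - (F.blockJac p μ *ᵥ d) i) := by
  by_contra! hcon
  have hd0 : 0 ≤ d := fun i => (hd i).le
  have hμ0 : 0 ≤ μ := fun i => (hμ.pos i).le
  have hform : ∀ i, (F.block p).form d d i = 0 := fun i => by
    have h1 := (F.block p).form_nonneg hd0 hd0 i
    have h2 := hAd i
    have h3 := hcon i
    simp only [Pi.zero_apply] at h1
    linarith
  have heq : ∀ i, (F.blockJac p μ *ᵥ d) i = d i := fun i => by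
    have h2 := hAd i
    have h3 := hcon i
    have h1 := hform i
    linarith
  have hquad : ∀ i j k, p i → p j → p k → F.quad i j k = 0 := by
    intro i j k hi hj hk
    have h1 := (F.block p).le_form hd0 hd0 ⟨i, hi⟩ ⟨j, hj⟩ ⟨k, hk⟩
    rw [hform, mul_assoc] at h1
    exact le_antisymm (nonpos_of_mul_nonpos_left h1 (mul_pos (hd _) (hd _)))
      (F.quad_nonneg _ _ _)
  have hA0 : ∀ i j, 0 ≤ F.blockJac p μ i j := fun i j => F.jac_nonneg hμ0 i j
  obtain ⟨i₀, hi₀⟩ := Finite.exists_min fun i : {i // p i} => μ i / d i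
  set c := μ i₀ / d i₀ with hc
  set m : {i // p i} → ℝ := fun i => μ i with hm
  set w : {i // p i} → ℝ := m - c • d with hw
  have hw0 : 0 ≤ w := by
    intro i
    have := (le_div_iff₀ (hd i)).mp (hi₀ i)
    simp only [hw, hm, Pi.zero_apply, Pi.sub_apply, Pi.smul_apply, smul_eq_mul]
    linarith
  have hwi₀ : w i₀ = 0 := by
    simp only [hw, hm, hc, Pi.sub_apply, Pi.smul_apply, smul_eq_mul,
      div_mul_cancel₀ _ (hd i₀).ne', sub_self]
  set z : σ → ℝ := fun j => if p j then 0 else μ j with hz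
  have hz0 : 0 ≤ z := by
    intro j; simp only [hz]; split_ifs
    · exact le_rfl
    · exact hμ0 j
  set ζ : σ → ℝ := fun j => if p j then μ j else 0 with hζ
  have hzζ : z + ζ = μ := by
    funext j
    by_cases hj : p j <;> simp [hz, hζ, hj]
  have hqζ : ∀ i j k, p i → p j → F.quad i j k * ζ k = 0 := by
    intro i j k hi hj
    by_cases hk : p k
    · rw [hquad i j k hi hj hk, zero_mul]
    · simp [hζ, hk]
  -- The inflow `F.val z` equals `(1 - A) μ` on the block, and subtracting `c • d` does not alter
  -- this because `A *ᵥ d = d`.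
  have hval : ∀ i : {i // p i}, F.val z i = w i - (F.blockJac p μ *ᵥ w) i := by
    intro i
    have h1 := congrFun (F.val_add z ζ) i
    rw [hzζ, hμ.val_eq] at h1
    have h2 : F.form ζ ζ i = 0 := by
      refine Finset.sum_eq_zero fun j _ => Finset.sum_eq_zero fun k _ => ?_
      by_cases hj : p j
      · rw [mul_right_comm, hqζ i j k i.2 hj, zero_mul]
      · simp [hζ, hj]
    have h3 : (F.jac z *ᵥ ζ) i = (F.blockJac p μ *ᵥ m) i := by
      rw [Matrix.mulVec, dotProduct, sum_eq_sum_subtype p (fun j hj => by simp [hζ, hj])]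
      refine Finset.sum_congr rfl fun j _ => ?_
      have h4 : F.jac μ i j = F.jac z i j := by
        rw [← hzζ, jac_add_apply, Finset.sum_eq_zero fun k _ => hqζ i j k i.2 j.2, mul_zero,
          add_zero]
      change F.jac z i j * ζ j = F.jac μ i j * μ j
      rw [h4]
      simp [hζ, j.2]
    have h5 : (F.blockJac p μ *ᵥ w) i = (F.blockJac p μ *ᵥ m) i - c * d i := by
      rw [hw, Matrix.mulVec_sub, Matrix.mulVec_smul, Pi.sub_apply, Pi.smul_apply, heq i,
        smul_eq_mul]
    have h6 : w i = μ i - c * d i := rfl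
    simp only [Pi.add_apply] at h1
    rw [h5, h6]
    linarith
  have hAw : F.blockJac p μ *ᵥ w ≤ w := by
    intro i
    have h1 := hval i
    have h2 := F.val_nonneg hz0 i
    simp only [Pi.zero_apply] at h2
    linarith
  have hwz : ∀ j, w j = 0 := by
    intro j
    by_contra hne
    have hj : 0 < w j := lt_of_le_of_ne (hw0 j) (Ne.symm hne)
    exact (hconn.pos_of_mulVec_le hA0 hw0 hAw hj i₀).ne' hwi₀
  obtain ⟨i, hi, hpos⟩ := hμ.productive p ⟨i₀.1, i₀.2⟩
  have h1 := hval ⟨i, hi⟩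
  have h2 : w = 0 := funext hwz
  rw [h2, Matrix.mulVec_zero] at h1
  simp only [Pi.zero_apply, sub_zero] at h1
  exact hpos.ne' h1

/-- `ν` consists of Newton iterates below `μ` and converges to `μ`. -/
structure IsNewtonSeq (F : QuadSystem σ) (μ : σ → ℝ) (ν : ℕ → σ → ℝ) : Prop where
  invariant : ∀ k, F.NewtonInvariant μ (ν k)
  step : ∀ k, F.IsNewtonStep (ν k) (ν (k + 1))
  tendsto : Tendsto ν atTop (𝓝 μ)

namespace IsNewtonSeq

variable {ν : ℕ → σ → ℝ}

theorem eventually_jac_ge (hν : F.IsNewtonSeq μ ν) (hμ0 : 0 ≤ μ) {s : ℝ} (hs : s < 1) :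
    ∀ᶠ k in atTop, ∀ i j, s * F.jac μ i j ≤ F.jac (ν k) i j := by
  rw [eventually_all]; intro i
  rw [eventually_all]; intro j
  rcases (F.jac_nonneg hμ0 i j).eq_or_lt with h | h
  · refine Eventually.of_forall fun k => ?_
    rw [← h, mul_zero]
    exact F.jac_nonneg (hν.invariant k).nonneg i j
  · have h1 : Tendsto (fun k => F.jac (ν k) i j) atTop (𝓝 (F.jac μ i j)) :=
      ((F.continuous_jac i j).tendsto μ).comp hν.tendsto
    have h2 : s * F.jac μ i j < F.jac μ i j := by nlinarith
    filter_upwards [h1.eventually (lt_mem_nhds h2)] with k hk using hk.le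

theorem antitone_error [DecidableEq σ] (hν : F.IsNewtonSeq μ ν) (k : ℕ) :
    μ - ν (k + 1) ≤ μ - ν k :=
  sub_le_sub_left ((hν.invariant k).le_step (hν.step k)) _

/-- The solution `W ≥ 1` of `(1 - F.jac (ν k)) W = 1` is superinvariant for `F.jac (ν k)`, which
eventually dominates `s * F.jac μ`. -/
theorem exists_pos_subinvariant [DecidableEq σ] (hν : F.IsNewtonSeq μ ν) (hμ0 : 0 ≤ μ)
    [Nonempty {i // p i}] (hconn : MatConnected (F.blockJac p μ)) :
    ∃ d : {i // p i} → ℝ, (∀ i, 0 < d i) ∧ F.blockJac p μ *ᵥ d ≤ d := by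
  refine hconn.exists_pos_subinvariant (fun i j => F.jac_nonneg hμ0 i j) fun s hs hs1 => ?_
  obtain ⟨k, hk⟩ := (hν.eventually_jac_ge hμ0 hs1).exists
  have hinv := hν.invariant k
  have hM0 := F.jac_nonneg hinv.nonneg
  have hu := (Matrix.isUnit_iff_isUnit_det _).mp (hinv.subcritical.isUnit hM0)
  set W : σ → ℝ := (1 - F.jac (ν k))⁻¹ *ᵥ 1 with hW
  have hW1 : W = F.jac (ν k) *ᵥ W + 1 := by
    have : (1 - F.jac (ν k)) *ᵥ W = 1 := by
      rw [hW, Matrix.mulVec_mulVec, Matrix.mul_nonsing_inv _ hu, Matrix.one_mulVec]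
    rw [Matrix.sub_mulVec, Matrix.one_mulVec] at this
    rw [← this]; abel
  have hWnn : 0 ≤ W := fun i => Finset.sum_nonneg fun j _ =>
    mul_nonneg (hinv.subcritical.inv_nonneg hM0 i j) zero_le_one
  have hWi : ∀ i, W i = (F.jac (ν k) *ᵥ W) i + 1 := fun i => congrFun hW1 i
  refine ⟨fun i => W i, fun i => hWnn i, fun h0 => ?_, fun i => ?_⟩
  · obtain ⟨i⟩ := ‹Nonempty {i // p i}›
    have h1 : W i = 0 := congrFun h0 i
    have h2 := F.mulVec_jac_nonneg hinv.nonneg hWnn i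
    have h3 := hWi i
    simp only [Pi.zero_apply] at h2
    linarith
  · have h1 : s * (F.blockJac p μ *ᵥ fun i => W i) i ≤ (F.jac (ν k) *ᵥ W) i := by
      rw [Matrix.mulVec, dotProduct, Finset.mul_sum, Matrix.mulVec, dotProduct,
        ← Fintype.sum_subtype_add_sum_subtype p]
      refine le_add_of_le_of_nonneg (Finset.sum_le_sum fun j _ => ?_)
        (Finset.sum_nonneg fun j _ => mul_nonneg (hM0 _ _) (hWnn j))
      rw [← mul_assoc]
      exact mul_le_mul_of_nonneg_right (hk i j) (hWnn j)
    have h3 := hWi i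
    linarith

/-- In the error equation every term that leaves the block contains the error of a variable on which
the block depends, hence a factor `C * s ^ 2`; the remaining factors are bounded in terms of `F.jac
μ`, `F.quad` and `μ`. -/
theorem exists_bound_residual (hν : F.IsNewtonSeq μ ν) (hμ : F.val μ = μ) (hμ0 : 0 ≤ μ) [DecidableEq σ]
    {C : ℝ} (hC : 0 ≤ C) :
    ∃ K, 0 ≤ K ∧ ∀ (k : ℕ) (s : ℝ),
      (∀ i j, p i → ¬ p j → 0 < F.jac μ i j → μ j - ν k j ≤ C * s ^ 2) →
      ∀ i : {i // p i},
        (μ - ν (k + 1)) i - ∑ j : {i // p i}, F.jac (ν k) i j * (μ - ν (k + 1)) j ≤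
          (F.block p).form (fun j => (μ - ν k) j) (fun j => (μ - ν k) j) i + K * s ^ 2 := by
  set b : σ → ℝ := fun i => ∑ j, F.jac μ i j + ∑ j, ∑ k, F.quad i j k * (μ j + μ k) with hb
  have hb0 : ∀ i, 0 ≤ b i := fun i => add_nonneg
    (Finset.sum_nonneg fun j _ => F.jac_nonneg hμ0 i j)
    (Finset.sum_nonneg fun j _ => Finset.sum_nonneg fun k _ =>
      mul_nonneg (F.quad_nonneg _ _ _) (add_nonneg (hμ0 j) (hμ0 k)))
  refine ⟨C * ∑ i, b i, mul_nonneg hC (Finset.sum_nonneg fun i _ => hb0 i), fun k s hs i => ?_⟩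
  have hinv := hν.invariant k
  set u := μ - ν k with hu
  set v := μ - ν (k + 1) with hv
  have hu0 : 0 ≤ u := sub_nonneg.mpr hinv.le_fixed
  have hv0 : 0 ≤ v := sub_nonneg.mpr (hν.invariant (k + 1)).le_fixed
  have huμ : u ≤ μ := sub_le_self _ hinv.nonneg
  have hvu : v ≤ u := hν.antitone_error k
  have hε : 0 ≤ C * s ^ 2 := by positivity
  have hjpos : ∀ j k, F.quad i j k ≠ 0 → 0 < μ k → 0 < F.jac μ i j := fun j k hq hk => by
    have h1 := F.quad_le_jac hμ0 i j k
    have h2 := mul_pos (lt_of_le_of_ne (F.quad_nonneg i j k) (Ne.symm hq)) hk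
    linarith
  have herr : v i = (F.jac (ν k) *ᵥ v) i + F.form u u i := by
    have := congrFun ((hν.step k).error hμ) i
    exact this
  rw [Matrix.mulVec, dotProduct, ← Fintype.sum_subtype_add_sum_subtype p] at herr
  have h1 : ∑ j : {j // ¬ p j}, F.jac (ν k) i j * v j ≤ C * s ^ 2 * ∑ j, F.jac μ i j := by
    rw [← Fintype.sum_subtype_add_sum_subtype p, mul_add]
    refine le_add_of_nonneg_of_le (mul_nonneg hε
      (Finset.sum_nonneg fun j _ => F.jac_nonneg hμ0 i j)) ?_
    rw [Finset.mul_sum]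
    refine Finset.sum_le_sum fun j _ => ?_
    rcases (F.jac_nonneg hμ0 i j).eq_or_lt with h0 | h0
    · have h2 := F.jac_mono hinv.le_fixed i j
      rw [← h0] at h2
      rw [le_antisymm h2 (F.jac_nonneg hinv.nonneg i j), ← h0]
      simp
    · calc F.jac (ν k) i j * v j ≤ F.jac μ i j * (C * s ^ 2) :=
            mul_le_mul (F.jac_mono hinv.le_fixed i j) ((hvu j).trans (hs i j i.2 j.2 h0))
              (hv0 j) h0.le
        _ = _ := mul_comm _ _
  have h2 : F.form u u i ≤ (F.block p).form (fun j => u j) (fun j => u j) i +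
      C * s ^ 2 * ∑ j, ∑ k, F.quad i j k * (μ j + μ k) := by
    have h3 : (F.block p).form (fun j => u j) (fun j => u j) i =
        ∑ j, ∑ k, if p j ∧ p k then F.quad i j k * u j * u k else 0 := by
      rw [sum_eq_sum_subtype p fun j hj => by simp [hj]]
      refine Finset.sum_congr rfl fun j _ => ?_
      rw [sum_eq_sum_subtype p fun k hk => by simp [hk]]
      refine Finset.sum_congr rfl fun k _ => ?_
      rw [if_pos ⟨j.2, k.2⟩]
      rfl
    rw [h3, Finset.mul_sum, ← Finset.sum_add_distrib]
    refine Finset.sum_le_sum fun j _ => ?_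
    rw [Finset.mul_sum, ← Finset.sum_add_distrib]
    refine Finset.sum_le_sum fun l _ => ?_
    have hq := F.quad_nonneg i j l
    have hrest : 0 ≤ C * s ^ 2 * (F.quad i j l * (μ j + μ l)) :=
      mul_nonneg hε (mul_nonneg hq (add_nonneg (hμ0 j) (hμ0 l)))
    by_cases hjl : p j ∧ p l
    · rw [if_pos hjl]
      exact le_add_of_nonneg_right hrest
    · rw [if_neg hjl, zero_add]
      rcases eq_or_ne (F.quad i j l) 0 with h0 | h0
      · simp [h0]
      · have hsmall : ∀ j l, F.quad i j l ≠ 0 → ¬ p j → F.quad i j l * u j * u l ≤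
            C * s ^ 2 * (F.quad i j l * (μ j + μ l)) := by
          intro j l h0 hj
          have hq := F.quad_nonneg i j l
          rcases (hμ0 l).eq_or_lt with hl | hl
          · have : u l = 0 := le_antisymm ((huμ l).trans hl.symm.le) (hu0 l)
            rw [this, mul_zero]
            exact mul_nonneg hε (mul_nonneg hq (add_nonneg (hμ0 j) (hμ0 l)))
          · have h4 : u j ≤ C * s ^ 2 := hs i j i.2 hj (hjpos j l h0 hl)
            calc F.quad i j l * u j * u l ≤ F.quad i j l * (C * s ^ 2) * μ l :=
                  mul_le_mul (mul_le_mul_of_nonneg_left h4 hq) (huμ l) (hu0 l)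
                    (mul_nonneg hq hε)
              _ = C * s ^ 2 * (F.quad i j l * μ l) := by ring
              _ ≤ _ := mul_le_mul_of_nonneg_left (mul_le_mul_of_nonneg_left
                  (le_add_of_nonneg_left (hμ0 j)) hq) hε
        rcases not_and_or.mp hjl with hj | hl
        · exact hsmall j l h0 hj
        · have := hsmall l j (by rwa [F.quad_symm]) hl
          rw [F.quad_symm i l j, mul_right_comm, add_comm] at this
          exact this
  have h5 : C * s ^ 2 * b i ≤ C * (∑ i, b i) * s ^ 2 := by
    have := Finset.single_le_sum (f := b) (fun i _ => hb0 i) (Finset.mem_univ i.1)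
    calc C * s ^ 2 * b i ≤ C * s ^ 2 * ∑ i, b i := mul_le_mul_of_nonneg_left this hε
      _ = _ := by ring
  have h6 : C * s ^ 2 * b i = C * s ^ 2 * ∑ j, F.jac μ i j +
      C * s ^ 2 * ∑ j, ∑ k, F.quad i j k * (μ j + μ k) := mul_add _ _ _
  linarith

/-- Error reduction in a strongly connected component. -/
theorem exists_block_error_reduction (hμ : F.IsProductiveFixedPt μ) (hν : F.IsNewtonSeq μ ν)
    [DecidableEq σ] [Nonempty {i // p i}] (hconn : MatConnected (F.blockJac p μ))
    {C : ℝ} (hC : 0 ≤ C) :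
    ∃ d : {i // p i} → ℝ, (∀ i, 0 < d i) ∧ ∃ K, 0 ≤ K ∧ ∀ᶠ k in atTop, ∀ s t : ℝ, 0 < s → s ≤ 1 →
      0 ≤ t → (∀ i j, p i → ¬ p j → 0 < F.jac μ i j → μ j - ν k j ≤ C * s ^ 2) →
      (∀ i : {i // p i}, μ i - ν k i ≤ t * d i) →
      ∀ i : {i // p i}, μ i - ν (k + 1) i ≤ (t / 2 + K * s) * d i := by
  have hμ0 : 0 ≤ μ := fun i => (hμ.pos i).le
  have hA0 : ∀ i j, 0 ≤ F.blockJac p μ i j := fun i j => F.jac_nonneg hμ0 i j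
  obtain ⟨d, hd, hAd⟩ := hν.exists_pos_subinvariant hμ0 hconn
  have hd0 : 0 ≤ d := fun i => (hd i).le
  obtain ⟨i₀, hi₀⟩ := hμ.exists_pos_block hconn hd hAd
  -- The slack `d - A *ᵥ d` in `g` is afterwards absorbed by replacing `q` with `q + a • d`, so that
  -- only the quadratic part remains.
  obtain ⟨q, a, hq, ha, hqa⟩ := hconn.exists_supersolution hA0 hd hAd
    (g := fun i => (F.block p).form d d i + (d i - (F.blockJac p μ *ᵥ d) i))
    (fun i => add_nonneg ((F.block p).form_nonneg hd0 hd0 i) (sub_nonneg.mpr (hAd i))) hi₀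
  have hsuper : ∀ i, 1 ≤ (q + a • d) i - (F.blockJac p μ *ᵥ (q + a • d)) i +
      a * (F.block p).form d d i := by
    intro i
    refine (hqa i).trans_eq ?_
    rw [Matrix.mulVec_add, Matrix.mulVec_smul]
    simp only [Pi.add_apply, Pi.smul_apply, smul_eq_mul]
    ring
  obtain ⟨κ, hκ, hharn⟩ := hconn.harnack hA0
  obtain ⟨R, hR, hres⟩ := hν.exists_bound_residual (p := p) hμ.val_eq hμ0 hC
  obtain ⟨K, hK, hred⟩ := (F.block p).exists_error_reduction hd hAd
    (add_nonneg hq (smul_nonneg ha hd0)) ha hκ hR hsuper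
  refine ⟨d, hd, K, hK, ?_⟩
  -- Late iterates satisfy `F.jac μ / 2 ≤ F.jac (ν k)`, so `F.jac (ν k) *ᵥ (μ - ν k) ≤ μ - ν k` puts
  -- the errors within the scope of `harnack`, with a constant independent of `k`.
  filter_upwards [hν.eventually_jac_ge hμ0 (s := 1 / 2) (by norm_num)] with k hk s t hs hs1 ht hlow hut
  have hinv := hν.invariant k
  have hu0 : 0 ≤ μ - ν k := sub_nonneg.mpr hinv.le_fixed
  have hM0 := F.jac_nonneg hinv.nonneg
  refine fun i => hred (F.blockJac p (ν k)) (fun i => (μ - ν k) i) (fun i => (μ - ν (k + 1)) i)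
    s t hs hs1 ht ?_ ?_ (fun i => hu0 i) (fun i => hut i) (fun i => hν.antitone_error k i) ?_
    (fun i => hres k s hlow i) i
  · exact fun z hz => hinv.subcritical.le_of_submatrix hM0 p hz
  · intro z hz i
    have h1 : ∀ j : {i // p i}, F.jac (ν k) i j + 2 * ∑ l : {i // p i}, F.quad i j l * (μ - ν k) l ≤
        F.jac μ i j := by
      intro j
      have h2 := F.jac_add_apply (ν k) (μ - ν k) i j
      rw [add_sub_cancel, ← Fintype.sum_subtype_add_sum_subtype p] at h2
      have h3 : 0 ≤ ∑ l : {i // ¬ p i}, F.quad i j l * (μ - ν k) l :=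
        Finset.sum_nonneg fun l _ => mul_nonneg (F.quad_nonneg _ _ _) (hu0 l)
      linarith
    have h4 : (F.block p).form (fun i => (μ - ν k) i) z i =
        ∑ j : {i // p i}, (∑ l : {i // p i}, F.quad i j l * (μ - ν k) l) * z j := by
      rw [form_comm]
      refine Finset.sum_congr rfl fun j _ => ?_
      rw [Finset.sum_mul]
      refine Finset.sum_congr rfl fun l _ => ?_
      change F.quad i j l * _ * _ = _
      ring
    simp only [Pi.add_apply, Pi.smul_apply, smul_eq_mul]
    rw [h4, Finset.mul_sum, Matrix.mulVec, Matrix.mulVec, dotProduct, dotProduct,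
      ← Finset.sum_add_distrib]
    refine Finset.sum_le_sum fun j _ => ?_
    have := mul_le_mul_of_nonneg_right (h1 j) (hz j)
    refine le_trans (le_of_eq ?_) this
    change F.jac (ν k) i j * z j + _ = _
    ring
  · refine hharn _ (fun i => hu0 i) fun i => ?_
    have h1 := jac_mulVec_error_le hμ.val_eq hinv.le_val hinv.le_fixed i
    refine le_trans ?_ h1
    rw [Matrix.mulVec, dotProduct, Finset.mul_sum, Matrix.mulVec, dotProduct,
        ← Fintype.sum_subtype_add_sum_subtype p]
    refine le_add_of_le_of_nonneg (Finset.sum_le_sum fun j _ => ?_)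
        (Finset.sum_nonneg fun j _ => mul_nonneg (hM0 _ _) (hu0 j))
    rw [← mul_assoc]
    exact mul_le_mul_of_nonneg_right (hk i j) (hu0 j)

end IsNewtonSeq

end QuadSystem

end MSP

end

/-! ### From polynomials to quadratic systems -/

noncomputable section

namespace MSP

open Matrix

variable {σ : Type*}

namespace QuadSystem

section Polynomial

open MvPolynomial

theorem exists_eq_add_single {m : σ →₀ ℕ} (hm : m ≠ 0) :
    ∃ (m' : σ →₀ ℕ) (i : σ), m = m' + Finsupp.single i 1 ∧ m.degree = m'.degree + 1 := by
  obtain ⟨i, hi⟩ := Finsupp.ne_iff.mp hm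
  have h : m = (m - Finsupp.single i 1) + Finsupp.single i 1 := by
    rw [tsub_add_cancel_of_le]
    rw [Finsupp.single_le_iff]
    exact Nat.one_le_iff_ne_zero.mpr hi
  refine ⟨m - Finsupp.single i 1, i, h, ?_⟩
  nth_rw 1 [h]
  rw [map_add, Finsupp.degree_single]

variable [Fintype σ]

/-- `p` is a polynomial of degree at most two with the given coefficients. -/
def HasQuadRep (p : MvPolynomial σ ℝ) (b : ℝ) (l : σ → ℝ) (q : σ → σ → ℝ) : Prop :=
  0 ≤ b ∧ (∀ j, 0 ≤ l j) ∧ (∀ j k, 0 ≤ q j k) ∧ (∀ j k, q j k = q k j) ∧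
    p = C b + ∑ j, C (l j) * X j + ∑ j, ∑ k, C (q j k) * X j * X k

theorem HasQuadRep.zero : HasQuadRep (0 : MvPolynomial σ ℝ) 0 0 0 := by
  refine ⟨le_rfl, fun _ => le_rfl, fun _ _ => le_rfl, fun _ _ => rfl, by simp⟩

theorem HasQuadRep.add {p p' : MvPolynomial σ ℝ} {b b' : ℝ} {l l' : σ → ℝ} {q q' : σ → σ → ℝ}
    (h : HasQuadRep p b l q) (h' : HasQuadRep p' b' l' q') :
    HasQuadRep (p + p') (b + b') (l + l') (q + q') := by
  obtain ⟨hb, hl, hq, hs, rfl⟩ := h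
  obtain ⟨hb', hl', hq', hs', rfl⟩ := h'
  refine ⟨add_nonneg hb hb', fun j => add_nonneg (hl j) (hl' j),
    fun j k => add_nonneg (hq j k) (hq' j k),
    fun j k => congrArg₂ (· + ·) (hs j k) (hs' j k), ?_⟩
  simp only [Pi.add_apply, map_add, add_mul, Finset.sum_add_distrib]
  ring

theorem HasQuadRep.of_C {c : ℝ} (hc : 0 ≤ c) : HasQuadRep (C c : MvPolynomial σ ℝ) c 0 0 :=
  ⟨hc, fun _ => le_rfl, fun _ _ => le_rfl, fun _ _ => rfl, by simp⟩

theorem HasQuadRep.of_linear [DecidableEq σ] {c : ℝ} (hc : 0 ≤ c) (i : σ) :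
    HasQuadRep (C c * X i : MvPolynomial σ ℝ) 0 (Pi.single i c) 0 := by
  refine ⟨le_rfl, fun j => ?_, fun _ _ => le_rfl, fun _ _ => rfl, ?_⟩
  · rw [Pi.single_apply]; split_ifs
    · exact hc
    · exact le_rfl
  · simp only [Pi.single_apply, Pi.zero_apply, map_zero, zero_mul, Finset.sum_const_zero, zero_add,
      add_zero]
    rw [Finset.sum_eq_single i] <;> simp +contextual

/-- The coefficient is split evenly between `(i, j)` and `(j, i)` to keep `q` symmetric; for `i = j`
the two halves add up. -/
theorem HasQuadRep.of_quadratic [DecidableEq σ] {c : ℝ} (hc : 0 ≤ c) (i j : σ) :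
    HasQuadRep (C c * X i * X j : MvPolynomial σ ℝ) 0 0
      (fun a b => (if a = i ∧ b = j then c / 2 else 0) + if a = j ∧ b = i then c / 2 else 0) := by
  refine ⟨le_rfl, fun _ => le_rfl, fun a b => ?_, fun a b => ?_, ?_⟩
  · have : 0 ≤ c / 2 := by positivity
    dsimp only
    split_ifs <;> linarith
  · dsimp only
    rw [add_comm]
    simp only [and_comm]
  · have key : ∀ i j : σ, ∑ a, ∑ b, C (if a = i ∧ b = j then c / 2 else 0) * X a * X b =
        (C (c / 2) * X i * X j : MvPolynomial σ ℝ) := by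
      intro i j
      rw [Finset.sum_eq_single i, Finset.sum_eq_single j] <;> simp +contextual
    simp only [map_add, add_mul, Finset.sum_add_distrib, key, Pi.zero_apply, map_zero, zero_mul,
      Finset.sum_const_zero, zero_add]
    have h : (C c : MvPolynomial σ ℝ) = C (c / 2) + C (c / 2) := by
      rw [← map_add, add_halves]
    rw [h]; ring

theorem HasQuadRep.exists_monomial {m : σ →₀ ℕ} (hm : m.degree ≤ 2) {c : ℝ} (hc : 0 ≤ c) :
    ∃ b l q, HasQuadRep (monomial m c) b l q := by
  classical
  rcases eq_or_ne m 0 with rfl | h0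
  · exact ⟨_, _, _, HasQuadRep.of_C hc⟩
  obtain ⟨m₁, i, rfl, hd⟩ := exists_eq_add_single h0
  rw [monomial_add_single, pow_one]
  rcases eq_or_ne m₁ 0 with rfl | h1
  · exact ⟨_, _, _, HasQuadRep.of_linear hc i⟩
  obtain ⟨m₂, j, rfl, hd'⟩ := exists_eq_add_single h1
  rw [monomial_add_single, pow_one]
  have h2 : m₂ = 0 := by
    rw [← Finsupp.degree_eq_zero_iff]; omega
  subst h2
  exact ⟨_, _, _, HasQuadRep.of_quadratic hc j i⟩

theorem exists_hasQuadRep {p : MvPolynomial σ ℝ} (hp : ∀ m, 0 ≤ p.coeff m)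
    (hdeg : p.totalDegree ≤ 2) : ∃ b l q, HasQuadRep p b l q := by
  rw [← support_sum_monomial_coeff p]
  refine Finset.sum_induction _ (fun p => ∃ b l q, HasQuadRep p b l q) ?_ ⟨_, _, _, .zero⟩ ?_
  · rintro _ _ ⟨_, _, _, h⟩ ⟨_, _, _, h'⟩
    exact ⟨_, _, _, h.add h'⟩
  · exact fun m hm => HasQuadRep.exists_monomial ((le_totalDegree hm).trans hdeg) (hp m)

theorem HasQuadRep.pderiv_eq [DecidableEq σ] {p : MvPolynomial σ ℝ} {b : ℝ} {l : σ → ℝ}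
    {q : σ → σ → ℝ} (h : HasQuadRep p b l q) (k : σ) :
    pderiv k p = C (l k) + 2 * ∑ j, C (q k j) * X j := by
  obtain ⟨-, -, -, hs, rfl⟩ := h
  have h1 : ∀ a : σ, pderiv k (X a : MvPolynomial σ ℝ) = if a = k then 1 else 0 := by
    intro a
    rw [pderiv_X, Pi.single_apply]
  simp only [map_add, map_sum, Derivation.leibniz, pderiv_C, h1, smul_eq_mul, mul_zero, add_zero,
    zero_add, mul_ite, mul_one, Finset.sum_add_distrib, Finset.sum_ite_eq', Finset.mem_univ, if_true]
  have h2 : ∑ a, C (q a k) * X a = (∑ a, C (q k a) * X a : MvPolynomial σ ℝ) :=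
    Finset.sum_congr rfl fun a _ => by rw [hs]
  have h3 : (∑ x, ∑ y, if x = k then X y * C (q x y) else 0) =
      (∑ a, C (q k a) * X a : MvPolynomial σ ℝ) := by
    rw [Finset.sum_eq_single k] <;> simp +contextual [mul_comm]
  rw [h2, h3]
  ring

/-- The coefficients of a quadratic monotone system. -/
theorem exists_quadSystem {f : σ → MvPolynomial σ ℝ} (hf : IsMSP f) (hquad : IsQuadratic f) :
    ∃ F : QuadSystem σ, value f = F.val ∧ jacobian f = F.jac ∧
      ∀ μ : σ → ℝ, (∀ i, 0 < μ i) → ∀ i k, DependsDirectly f i k ↔ 0 < F.jac μ i k := by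
  classical
  choose b l q h using fun i => exists_hasQuadRep (hf i) (hquad i)
  let F : QuadSystem σ := ⟨b, l, q, fun i => (h i).1, fun i => (h i).2.1, fun i => (h i).2.2.1,
    fun i => (h i).2.2.2.1⟩
  have hjac : jacobian f = F.jac := by
    funext x
    ext i k
    rw [jacobian, Matrix.of_apply, (h i).pderiv_eq, jac_apply]
    simp only [map_add, map_mul, map_sum, eval_C, eval_X, map_ofNat]
    rfl
  refine ⟨F, ?_, hjac, fun μ hμ i k => ⟨fun hd => ?_, fun hpos hd => ?_⟩⟩
  · funext x i
    rw [value, (h i).2.2.2.2]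
    simp only [map_add, map_mul, map_sum, eval_C, eval_X]
    rfl
  · by_contra hcon
    have hμ0 : 0 ≤ μ := fun i => (hμ i).le
    have h0 : F.jac μ i k = 0 := le_antisymm (not_lt.mp hcon) (F.jac_nonneg hμ0 i k)
    have hq : ∀ j, q i k j = 0 := fun j => by
      have h1 := F.quad_le_jac hμ0 i k j
      have h2 : F.quad i k j ≤ 0 := nonpos_of_mul_nonpos_left (b := μ j) (by linarith) (hμ j)
      exact le_antisymm h2 (F.quad_nonneg i k j)
    have hl : l i k = 0 := by
      rw [jac_apply] at h0
      have h1 : ∑ j, F.quad i k j * μ j = 0 :=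
        Finset.sum_eq_zero fun j _ => by
          change q i k j * μ j = 0
          rw [hq, zero_mul]
      rw [h1, mul_zero, add_zero] at h0
      exact h0
    apply hd
    rw [(h i).pderiv_eq]
    simp [hl, hq]
  · have h1 : F.jac μ i k = 0 := by
      rw [← hjac, jacobian, Matrix.of_apply, hd, map_zero]
    exact hpos.ne' h1

end Polynomial

/-! ### Kleene iteration and productivity -/

section Kleene

variable [Fintype σ] (F : QuadSystem σ)

theorem iterate_nonneg_and_le {y : σ → ℝ} (hy : 0 ≤ y) (hval : F.val y = y) (k : ℕ) :
    0 ≤ F.val^[k] 0 ∧ F.val^[k] 0 ≤ y := by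
  induction k with
  | zero => exact ⟨le_rfl, hy⟩
  | succ k ih =>
    rw [Function.iterate_succ_apply']
    exact ⟨F.val_nonneg ih.1, (F.val_mono ih.1 ih.2).trans_eq hval⟩

/-- The least nonnegative fixed point is the limit of the Kleene sequence. -/
theorem exists_tendsto_iterate {y : σ → ℝ} (hy : 0 ≤ y) (hval : F.val y = y) :
    ∃ μ : σ → ℝ, 0 ≤ μ ∧ F.val μ = μ ∧ Tendsto (fun k => F.val^[k] 0) atTop (𝓝 μ) := by
  have hmono : Monotone fun k => F.val^[k] (0 : σ → ℝ) := by
    refine monotone_nat_of_le_succ fun k => ?_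
    induction k with
    | zero => exact F.val_nonneg le_rfl
    | succ k ih =>
      rw [Function.iterate_succ_apply', Function.iterate_succ_apply' _ (k + 1)]
      exact F.val_mono (F.iterate_nonneg_and_le hy hval k).1 ih
  have hlim : ∀ i, ∃ a, Tendsto (fun k => F.val^[k] (0 : σ → ℝ) i) atTop (𝓝 a) := fun i =>
    ⟨_, tendsto_atTop_ciSup (fun _ _ h => hmono h i)
      ⟨y i, by rintro _ ⟨k, rfl⟩; exact (F.iterate_nonneg_and_le hy hval k).2 i⟩⟩
  choose μ hμ using hlim
  have hμ' : Tendsto (fun k => F.val^[k] 0) atTop (𝓝 μ) := tendsto_pi_nhds.mpr hμ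
  refine ⟨μ, ge_of_tendsto' hμ' fun k => (F.iterate_nonneg_and_le hy hval k).1, ?_, hμ'⟩
  have h1 : Tendsto (fun k => F.val^[k + 1] 0) atTop (𝓝 (F.val μ)) := by
    simp only [Function.iterate_succ_apply']
    exact (F.continuous_val.tendsto μ).comp hμ'
  exact tendsto_nhds_unique h1 (hμ'.comp (tendsto_add_atTop_nat 1))

/-- If `F` vanished on `p` at the vector that is zero on `p` and `μ` elsewhere, that vector would
bound all Kleene iterates, so the variables in `p` would never become positive. -/
theorem isProductiveFixedPt_of_iterate {μ : σ → ℝ} (hμ0 : 0 ≤ μ) (hμ : F.val μ = μ)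
    (hclean : ∀ i, ∃ k, 0 < F.val^[k] 0 i) : F.IsProductiveFixedPt μ where
  pos i := by
    obtain ⟨k, hk⟩ := hclean i
    exact hk.trans_le ((F.iterate_nonneg_and_le hμ0 hμ k).2 i)
  val_eq := hμ
  productive := by
    intro p _ ⟨i, hi⟩
    by_contra! hcon
    have key : ∀ k, F.val^[k] 0 ≤ fun j => if p j then 0 else μ j := by
      intro k
      induction k with
      | zero =>
        intro j
        dsimp only [Function.iterate_zero, id]
        split_ifs
        · exact le_rfl
        · exact hμ0 j
      | succ k ih =>
        intro j
        by_cases hj : p j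
        · rw [Function.iterate_succ_apply']
          simp only [hj, if_true]
          exact (F.val_mono (F.iterate_nonneg_and_le hμ0 hμ k).1 ih j).trans (hcon j hj)
        · simp only [hj, if_false]
          exact (F.iterate_nonneg_and_le hμ0 hμ (k + 1)).2 j
    obtain ⟨k, hk⟩ := hclean i
    have := key k i
    simp only [hi, if_true] at this
    exact hk.not_ge this

end Kleene

/-! ### Convergence of the Newton sequence and rates in one component -/

variable [Fintype σ] {F : QuadSystem σ} {μ : σ → ℝ}

theorem NewtonInvariant.isNewtonStep [DecidableEq σ] {x : σ → ℝ} (hx : F.NewtonInvariant μ x) :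
    F.IsNewtonStep x (x + (1 - F.jac x)⁻¹ *ᵥ (F.val x - x)) := by
  have hu := (Matrix.isUnit_iff_isUnit_det _).mp
    (hx.subcritical.isUnit (F.jac_nonneg hx.nonneg))
  rw [IsNewtonStep, add_sub_cancel_left]
  have h : (1 - F.jac x) *ᵥ ((1 - F.jac x)⁻¹ *ᵥ (F.val x - x)) = F.val x - x := by
    rw [Matrix.mulVec_mulVec, Matrix.mul_nonsing_inv _ hu, Matrix.one_mulVec]
  rw [Matrix.sub_mulVec, Matrix.one_mulVec, sub_eq_iff_eq_add] at h
  exact h.trans (add_comm _ _)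

/-- Convergence is a squeeze: a Newton step is at least a Kleene step, and the iterates stay below
`μ`. -/
theorem IsProductiveFixedPt.isNewtonSeq [DecidableEq σ] (hμ : F.IsProductiveFixedPt μ)
    (hlim : Tendsto (fun k => F.val^[k] 0) atTop (𝓝 μ)) {ν : ℕ → σ → ℝ} (h0 : ν 0 = 0)
    (hν : ∀ k, ν (k + 1) = ν k + (1 - F.jac (ν k))⁻¹ *ᵥ (F.val (ν k) - ν k)) :
    F.IsNewtonSeq μ ν := by
  have hinv : ∀ k, F.NewtonInvariant μ (ν k) := by
    intro k
    induction k with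
    | zero => rw [h0]; exact hμ.newtonInvariant_zero
    | succ k ih => rw [hν]; exact ih.step hμ ih.isNewtonStep
  have hstep : ∀ k, F.IsNewtonStep (ν k) (ν (k + 1)) := fun k => by
    rw [hν]; exact (hinv k).isNewtonStep
  refine ⟨hinv, hstep, tendsto_pi_nhds.mpr fun i =>
    tendsto_of_tendsto_of_tendsto_of_le_of_le (tendsto_pi_nhds.mp hlim i) tendsto_const_nhds
      (fun k => ?_) fun k => (hinv k).le_fixed i⟩
  dsimp only
  suffices h : F.val^[k] 0 ≤ ν k from h i
  induction k with
  | zero => rw [h0]; rfl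
  | succ k ih =>
    rw [Function.iterate_succ_apply']
    exact (F.val_mono (F.iterate_nonneg_and_le (fun i => (hμ.pos i).le) hμ.val_eq k).1 ih).trans
      ((hinv k).val_le_step (hstep k))

namespace IsNewtonSeq

variable {ν : ℕ → σ → ℝ} {p : σ → Prop}

theorem exists_rate_of_eventually (hν : F.IsNewtonSeq μ ν) {q : ℝ} (hq : 0 < q)
    (hq1 : q ≤ 1) {d : {i // p i} → ℝ} {D : ℝ} {k₀ : ℕ}
    (h : ∀ k, k₀ ≤ k → ∀ i : {i // p i}, μ i - ν k i ≤ D * q ^ k * d i) :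
    ∃ C, 0 ≤ C ∧ ∀ k i, p i → μ i - ν k i ≤ C * q ^ k := by
  -- The second entry of the maximum covers the indices before `k₀`, where the error is at most `μ
  -- i`.
  obtain ⟨C, hC, hle⟩ := exists_bound_forall
    (fun i : {i // p i} => max (D * d i) (μ i / q ^ k₀)) fun _ => one_pos
  refine ⟨C, hC, fun k i hi => ?_⟩
  have hqk : 0 < q ^ k := pow_pos hq k
  have h1 := hle ⟨i, hi⟩
  rw [mul_one] at h1
  rcases le_or_gt k₀ k with hk | hk
  · refine (h k hk ⟨i, hi⟩).trans ?_
    rw [mul_right_comm]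
    exact mul_le_mul_of_nonneg_right ((le_max_left _ _).trans h1) hqk.le
  · have h2 : μ i ≤ C * q ^ k₀ := (div_le_iff₀ (pow_pos hq k₀)).mp ((le_max_right _ _).trans h1)
    have h3 : C * q ^ k₀ ≤ C * q ^ k :=
      mul_le_mul_of_nonneg_left (pow_le_pow_of_le_one hq.le hq1 hk.le) hC
    have h4 := (hν.invariant k).nonneg i
    simp only [Pi.zero_apply] at h4
    linarith

variable [DecidablePred p] [DecidableEq σ] [Nonempty {i // p i}]

/-- A component which depends on no others converges with rate `1 / 2`. -/
theorem exists_rate_bottom (hν : F.IsNewtonSeq μ ν) (hμ : F.IsProductiveFixedPt μ)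
    (hconn : MatConnected (F.blockJac p μ)) (hlow : ∀ i j, p i → ¬ p j → ¬ 0 < F.jac μ i j) :
    ∃ C, 0 ≤ C ∧ ∀ k i, p i → μ i - ν k i ≤ C * (1 / 2) ^ k := by
  obtain ⟨d, hd, K, hK, hev⟩ := exists_block_error_reduction hμ hν hconn le_rfl
  obtain ⟨k₀, hk₀⟩ := eventually_atTop.mp hev
  obtain ⟨T, hT, hTle⟩ := exists_bound_forall (fun i : {i // p i} => μ i - ν k₀ i) hd
  refine hν.exists_rate_of_eventually (by norm_num) (by norm_num) (d := d) (D := T * 2 ^ k₀)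
    (k₀ := k₀) fun k hk => ?_
  induction k, hk using Nat.le_induction with
  | base =>
    intro i
    have : T * 2 ^ k₀ * (1 / 2 : ℝ) ^ k₀ = T := by
      rw [mul_assoc, ← mul_pow]; norm_num
    rw [this]
    exact hTle i
  | succ k hk ih =>
    intro i
    set t := T * 2 ^ k₀ * (1 / 2 : ℝ) ^ k with ht
    have ht0 : 0 ≤ t := by positivity
    have hstep : ∀ s : ℝ, 0 < s → s ≤ 1 → μ i - ν (k + 1) i ≤ (t / 2 + K * s) * d i :=
      fun s hs hs1 => hk₀ k hk s t hs hs1 ht0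
        (fun i j hi hj hij => absurd hij (hlow i j hi hj)) ih i
    -- With nothing below, the step bound holds for every small `s > 0`; letting `s` tend to zero
    -- removes the term `K * s`.
    have hlim : Tendsto (fun s : ℝ => (t / 2 + K * s) * d i) (𝓝[>] 0)
        (𝓝 ((t / 2 + K * 0) * d i)) := by
      refine Tendsto.mono_left (Continuous.tendsto ?_ 0) nhdsWithin_le_nhds
      fun_prop
    have := ge_of_tendsto hlim (by
      filter_upwards [Ioc_mem_nhdsGT one_pos] with s hs using hstep s hs.1 hs.2)
    refine this.trans_eq ?_
    rw [ht, pow_succ]; ring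

/-- If the components below converge with rate `q ^ 2` then a component converges with rate `q`. -/
theorem exists_rate_of_lower (hν : F.IsNewtonSeq μ ν) (hμ : F.IsProductiveFixedPt μ)
    (hconn : MatConnected (F.blockJac p μ)) {C q : ℝ} (hC : 0 ≤ C) (hq : 1 / 2 < q) (hq1 : q ≤ 1)
    (hlow : ∀ i j, p i → ¬ p j → 0 < F.jac μ i j → ∀ k, μ j - ν k j ≤ C * (q ^ 2) ^ k) :
    ∃ C', 0 ≤ C' ∧ ∀ k i, p i → μ i - ν k i ≤ C' * q ^ k := by
  have hq0 : 0 < q := by linarith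
  obtain ⟨d, hd, K, hK, hev⟩ := exists_block_error_reduction hμ hν hconn hC
  obtain ⟨k₀, hk₀⟩ := eventually_atTop.mp hev
  obtain ⟨T, hT, hTle⟩ := exists_bound_forall (fun i : {i // p i} => μ i - ν k₀ i) hd
  -- The first summand starts the induction at `k₀`; the second makes `D / 2 + K ≤ D * q`, which is
  -- the induction step with `s = q ^ k`.
  set D := T / q ^ k₀ + K / (q - 1 / 2) with hD
  have hq2 : 0 < q - 1 / 2 := by linarith
  have hD0 : 0 ≤ D := by positivity
  refine hν.exists_rate_of_eventually hq0 hq1 (d := d) (D := D) (k₀ := k₀) fun k hk => ?_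
  induction k, hk using Nat.le_induction with
  | base =>
    intro i
    refine (hTle i).trans (mul_le_mul_of_nonneg_right ?_ (hd i).le)
    rw [hD, add_mul, div_mul_cancel₀ _ (pow_pos hq0 _).ne']
    exact le_add_of_nonneg_right (by positivity)
  | succ k hk ih =>
    intro i
    have hqk : 0 < q ^ k := pow_pos hq0 k
    refine (hk₀ k hk (q ^ k) (D * q ^ k) hqk (pow_le_one₀ hq0.le hq1) (by positivity)
      (fun i j hi hj hij => ?_) ih i).trans (mul_le_mul_of_nonneg_right ?_ (hd i).le)
    · rw [← pow_mul, mul_comm k 2, pow_mul]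
      exact hlow i j hi hj hij k
    · have h1 : K ≤ D * (q - 1 / 2) := by
        rw [hD, add_mul, div_mul_cancel₀ _ hq2.ne']
        exact le_add_of_nonneg_left (by positivity)
      have h2 := mul_le_mul_of_nonneg_right h1 hqk.le
      rw [pow_succ]
      linarith

end IsNewtonSeq

end QuadSystem

end MSP

end

/-! ### Induction along the DAG of components -/

noncomputable section

namespace MSP

variable {σ : Type*}

/-- The convergence rate `2 ^ (-1 / 2 ^ l)`. -/
def rate (l : ℕ) : ℝ :=
  Real.sqrt^[l] (1 / 2)

theorem rate_succ_sq_and_bounds (l : ℕ) :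
    rate (l + 1) ^ 2 = rate l ∧ 1 / 2 ≤ rate l ∧ rate l < 1 := by
  have hsucc : ∀ l, rate (l + 1) = √(rate l) := fun l => Function.iterate_succ_apply' _ _ _
  have hb : 1 / 2 ≤ rate l ∧ rate l < 1 := by
    induction l with
    | zero => norm_num [rate]
    | succ l ih =>
      rw [hsucc]
      refine ⟨Real.le_sqrt_of_sq_le ?_, ?_⟩
      · norm_num; linarith
      · rw [Real.sqrt_lt' one_pos]; linarith
  refine ⟨?_, hb⟩
  rw [hsucc, Real.sq_sqrt (by linarith)]

theorem half_lt_rate_succ (l : ℕ) : 1 / 2 < rate (l + 1) := by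
  obtain ⟨h, h1, -⟩ := rate_succ_sq_and_bounds l
  have h2 := (rate_succ_sq_and_bounds (l + 1)).2.1
  nlinarith

theorem rate_pow_two_pow (l : ℕ) : rate l ^ 2 ^ l = 1 / 2 := by
  induction l with
  | zero => simp [rate]
  | succ l ih => rw [pow_succ', pow_mul, (rate_succ_sq_and_bounds l).1, ih]

theorem matConnected_blockJac [Fintype σ] {f : σ → MvPolynomial σ ℝ} {F : QuadSystem σ}
    {μ : σ → ℝ} (hdep : ∀ i k, DependsDirectly f i k ↔ 0 < F.jac μ i k) (S : SCC f) :
    MatConnected (F.blockJac (fun j => sccOf f j = S) μ) := by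
  rintro ⟨i, hi⟩ ⟨j, hj⟩
  have hij : Depends f i j ∧ Depends f j i :=
    (Quotient.exact (hi.trans hj.symm) : (mutualSetoid f).r i j)
  -- A dependence path between two variables of a component never leaves it, as each intermediate
  -- variable also depends on `i`.
  have key : ∀ c, Depends f i c → Depends f c i → ∀ hc : sccOf f c = S,
      Relation.ReflTransGen (fun a b => 0 < F.blockJac (fun j => sccOf f j = S) μ a b)
        ⟨i, hi⟩ ⟨c, hc⟩ := by
    intro c hic
    induction hic with
    | refl => exact fun _ _ => .refl
    | @tail b c hib hbc ih =>
      intro hci hc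
      have hbi : Depends f b i := Relation.ReflTransGen.head hbc hci
      have hb : sccOf f b = S := by
        rw [← hi]
        exact Quotient.sound (show (mutualSetoid f).r b i from ⟨hbi, hib⟩)
      exact (ih hbi hb).tail ((hdep b c).mp hbc)
  exact key j hij.1 hij.2 hj

/-- If all paths from the component of `X i` have length at most `l`, then the Newton sequence
converges in that component with rate `rate l`. -/
theorem exists_rate_of_path_length_le [Fintype σ] [DecidableEq σ] {f : σ → MvPolynomial σ ℝ}
    {F : QuadSystem σ} {μ : σ → ℝ} {ν : ℕ → σ → ℝ} (hμ : F.IsProductiveFixedPt μ)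
    (hν : F.IsNewtonSeq μ ν) (hdep : ∀ i k, DependsDirectly f i k ↔ 0 < F.jac μ i k) (l : ℕ) :
    ∀ i, (∀ p : RelSeries (sccEdge f), p.head = sccOf f i → p.length ≤ l) →
      ∃ C, 0 ≤ C ∧ ∀ k, μ i - ν k i ≤ C * rate l ^ k := by
  classical
  have hedge : ∀ i a b, sccOf f a = sccOf f i → ¬ sccOf f b = sccOf f i → 0 < F.jac μ a b →
      (sccOf f i, sccOf f b) ∈ sccEdge f := fun i a b ha hb hab =>
    ⟨fun h => hb h.symm, a, b, ha, rfl, (hdep a b).mpr hab⟩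
  induction l with
  | zero =>
    intro i hi
    have : Nonempty {j // sccOf f j = sccOf f i} := ⟨⟨i, rfl⟩⟩
    obtain ⟨C, hC, h⟩ := hν.exists_rate_bottom (p := fun j => sccOf f j = sccOf f i) hμ
      (matConnected_blockJac hdep _) fun a b ha hb hab => by
        have := hi ((RelSeries.singleton (sccEdge f) (sccOf f b)).cons (sccOf f i)
          (hedge i a b ha hb hab)) (RelSeries.head_cons _ _ _)
        exact absurd this (Nat.not_succ_le_zero _)
    exact ⟨C, hC, fun k => h k i rfl⟩
  | succ l ih =>
    intro i hi
    have : Nonempty {j // sccOf f j = sccOf f i} := ⟨⟨i, rfl⟩⟩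
    have hlow : ∀ b, ∃ C, 0 ≤ C ∧ ((sccOf f i, sccOf f b) ∈ sccEdge f →
        ∀ k, μ b - ν k b ≤ C * rate l ^ k) := by
      intro b
      by_cases hb : (sccOf f i, sccOf f b) ∈ sccEdge f
      -- A path starting at a lower component becomes one edge longer when the present component is
      -- prepended.
      · obtain ⟨C, hC, h⟩ := ih b fun p hp => by
          have := hi (p.cons (sccOf f i) (by rw [hp]; exact hb)) (RelSeries.head_cons _ _ _)
          change 0 + p.length + 1 ≤ l + 1 at this
          omega
        exact ⟨C, hC, fun _ => h⟩
      · exact ⟨0, le_rfl, fun h => absurd h hb⟩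
    choose C hC hCle using hlow
    have hrate := rate_succ_sq_and_bounds l
    have hrate' := rate_succ_sq_and_bounds (l + 1)
    obtain ⟨C', hC', h⟩ := hν.exists_rate_of_lower (p := fun j => sccOf f j = sccOf f i) hμ
      (matConnected_blockJac hdep _) (C := ∑ b, C b) (Finset.sum_nonneg fun b _ => hC b)
      (half_lt_rate_succ l) hrate'.2.2.le fun a b ha hb hab k => by
        rw [hrate.1]
        refine (hCle b (hedge i a b ha hb hab) k).trans (mul_le_mul_of_nonneg_right ?_
          (pow_nonneg (by linarith) k))
        exact Finset.single_le_sum (fun b _ => hC b) (Finset.mem_univ b)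
    exact ⟨C', hC', fun k => h k i rfl⟩

end MSP

end

/-! ### The main theorem -/

theorem theorem6p2 (n : ℕ) (f : Fin n → MvPolynomial (Fin n) ℝ)
    (hf : MSP.IsMSP f) (hclean : MSP.IsClean f) (hfeas : MSP.IsFeasible f)
    (hquad : MSP.IsQuadratic f) :
    ∃ μ : Fin n → ℝ, IsLeast (MSP.fixedPts f) μ ∧
      (∀ k, IsUnit (1 - MSP.jacobian f (MSP.newton f k))) ∧
      Tendsto (MSP.newton f) atTop (𝓝 μ) ∧
      MSP.ConvergesLinearly (MSP.newton f) μ ∧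
      ∃ kf : ℕ, ∀ i : ℕ,
        MSP.HasValidBits μ
          (MSP.newton f (kf + i * (MSP.height f + 1) * 2 ^ MSP.height f)) i := by
  obtain ⟨F, hval, hjac, hdep⟩ := MSP.QuadSystem.exists_quadSystem hf hquad
  obtain ⟨y, hy, hyval⟩ := hfeas
  rw [hval] at hyval
  obtain ⟨μ, hμ0, hμ, hlim⟩ := F.exists_tendsto_iterate hy hyval
  have hprod : F.IsProductiveFixedPt μ := by
    refine F.isProductiveFixedPt_of_iterate hμ0 hμ fun i => ?_
    obtain ⟨k, hk⟩ := hclean i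
    rw [MSP.kleene, hval] at hk
    exact ⟨k, hk⟩
  have hν : F.IsNewtonSeq μ (MSP.newton f) := by
    refine hprod.isNewtonSeq hlim rfl fun k => ?_
    rw [MSP.newton, Function.iterate_succ_apply', MSP.newtonOp, hval, hjac]
    rfl
  have hrate : ∀ i, ∃ C, 0 ≤ C ∧
      ∀ k, μ i - MSP.newton f k i ≤ C * MSP.rate (MSP.height f) ^ k := fun i =>
    MSP.exists_rate_of_path_length_le hprod hν (hdep μ hprod.pos) _ i fun p _ =>
      le_csSup (MSP.bddAbove_pathLengths f) ⟨p, rfl⟩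
  choose C hC hCle using hrate
  obtain ⟨-, hr1, hr2⟩ := MSP.rate_succ_sq_and_bounds (MSP.height f)
  have hpow := MSP.rate_pow_two_pow (MSP.height f)
  set h := MSP.height f with hh
  set r := MSP.rate h with hr
  have hr0 : 0 < r := by linarith
  have habs : ∀ k i, |μ i - MSP.newton f k i| ≤ C i * r ^ k := fun k i => by
    rw [abs_of_nonneg (sub_nonneg.mpr ((hν.invariant k).le_fixed i))]
    exact hCle i k
  refine ⟨μ, ⟨⟨hμ0, by rw [hval]; exact hμ⟩, ?_⟩, fun k => ?_, hν.tendsto, ?_, ?_⟩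
  · rintro z ⟨hz0, hz⟩
    rw [hval] at hz
    exact le_of_tendsto' hlim fun k => (F.iterate_nonneg_and_le hz0 hz k).2
  · rw [hjac]
    exact (hν.invariant k).subcritical.isUnit (F.jac_nonneg (hν.invariant k).nonneg)
  · refine ⟨∑ i, C i, r, hr0.le, hr2, fun k => ?_⟩
    have hk : 0 ≤ r ^ k := pow_nonneg hr0.le k
    refine (pi_norm_le_iff_of_nonneg
      (mul_nonneg (Finset.sum_nonneg fun i _ => hC i) hk)).mpr fun i => ?_
    rw [Pi.sub_apply, norm_sub_rev, Real.norm_eq_abs]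
    exact (habs k i).trans (mul_le_mul_of_nonneg_right
      (Finset.single_le_sum (fun i _ => hC i) (Finset.mem_univ i)) hk)
  · obtain ⟨D, hD, hDle⟩ := MSP.exists_bound_forall C hprod.pos
    -- `D` bounds the ratios `C j / μ j`, so after `kf` steps the relative error bound `D * r ^ kf`
    -- is at most one.
    obtain ⟨kf, hkf⟩ := exists_pow_lt_of_lt_one (show 0 < 1 / (D + 1) by positivity) hr2
    refine ⟨kf, fun i j => ?_⟩
    rw [abs_of_pos (hprod.pos j), div_le_iff₀ (hprod.pos j)]
    have hDr : D * r ^ kf ≤ 1 := by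
      rw [lt_div_iff₀ (by positivity)] at hkf
      have := pow_pos hr0 kf
      linarith
    -- Every `2 ^ h` further steps gain one bit, since `r ^ 2 ^ h = 1 / 2`; the factor `h + 1` only
    -- adds more steps.
    have hexp : r ^ (i * (h + 1) * 2 ^ h) ≤ (2 : ℝ) ^ (-(i : ℤ)) := by
      have h1 : r ^ (i * (h + 1) * 2 ^ h) = (1 / 2 : ℝ) ^ (i * (h + 1)) := by
        rw [mul_comm, pow_mul, hpow]
      have h2 : (2 : ℝ) ^ (-(i : ℤ)) = (1 / 2 : ℝ) ^ i := by
        rw [zpow_neg, zpow_natCast, one_div, inv_pow]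
      rw [h1, h2]
      exact pow_le_pow_of_le_one (by norm_num) (by norm_num)
        (Nat.le_mul_of_pos_right i (Nat.succ_pos h))
    have hμj := (hprod.pos j).le
    calc |μ j - MSP.newton f (kf + i * (h + 1) * 2 ^ h) j|
        ≤ C j * r ^ (kf + i * (h + 1) * 2 ^ h) := habs _ j
      _ ≤ D * μ j * r ^ (kf + i * (h + 1) * 2 ^ h) :=
        mul_le_mul_of_nonneg_right (hDle j) (pow_nonneg hr0.le _)
      _ = D * r ^ kf * (r ^ (i * (h + 1) * 2 ^ h) * μ j) := by rw [pow_add]; ring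
      _ ≤ 1 * ((2 : ℝ) ^ (-(i : ℤ)) * μ j) :=
        mul_le_mul hDr (mul_le_mul_of_nonneg_right hexp hμj)
          (mul_nonneg (pow_nonneg hr0.le _) hμj) zero_le_one
      _ = _ := one_mul _
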